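/- **Problem.** Let $m\in\mathbb N$, $f^0,\dots,f^m:\mathbb R^d\to\mathbb R$ be continuous, $\mathcal X=\{x: f^i(x)\le 0,\ i=1,\dots,m\}$, and consider $\min f^0(x)$ s.t. $x\in\mathcal X$. Assume: $\|x-y\|\le R$ for $x,y\in\mathcal X$; on $\mathcal X$ each $f^i$ is differentiable, $L_i$-Lipschitz and $M_i$-smooth, i.e. $f^i(x)\le f^i(y)+\langle\nabla f^i(y),x-y\rangle+\frac{M_i}{2}\|x-y\|^2$ for $x,y\in\mathcal X$ ($L_i,M_i>0$; $L=\max_i L_i$, $M=\max_i M_i$); a point $x_0$ with $\max_{1\le i\le m} f^i(x_0)\le-\beta<0$ is known; and the extended MFCQ holds: for some $\rho\in(0,\beta/2]$ and $l>0$, for every $x\in\mathcal X$ there is a unit vector $s_x$ with $\langle s_x,\nabla f^i(x)\rangle>l$ for all $i\in\{1,\dots,m\}$ with $-f^i(x)\le\rho$. **Oracle.** For $0\le i\le m$ a query at $x$ returns $(F^i(x,\xi),G^i(x,\xi))$, with $\xi$ a fresh i.i.d. sample. For $x\in\mathcal X$: $\mathbb E F^i(x,\xi)=f^i(x)$ and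 $\mathbb P\{|F^i(x,\xi)-f^i(x)|\le\sigma_i\sqrt{\ln(1/p)}\}\ge1-p$ for all $p\in(0,1)$; $\|\mathbb E G^i(x,\xi)-\nabla f^i(x)\|\le\hat b_i$ and $\mathbb P\{\|G^i(x,\xi)-\mathbb E G^i(x,\xi)\|\le\hat\sigma_i\sqrt{\ln(1/p)}\}\ge1-p$ for all $p\in(0,1)$. Write $F^i_n,G^i_n$ for means over a batch of $n\ge1$ samples, $\sigma_i(n)=\sigma_i/\sqrt n$, $\hat\sigma_i(n)=\hat\sigma_i/\sqrt n$. **Algorithm (LB-SGD, fixed $\eta>0$).** Let $B_\eta(x)=f^0(x)-\eta\sum_{i=1}^m\log(-f^i(x))$ on $\{x:f^i(x)<0,\ 1\le i\le m\}$. At iteration $t=0,1,\dots$, with a new batch at $x_t$, put $$g_t=G^0_n(x_t)+\eta\sum_{i=1}^m\frac{G^i_n(x_t)}{-F^i_n(x_t)},\quad \underline\alpha^i_t=-F^i_n(x_t)-\sigma_i(n)\sqrt{\ln\tfrac1\delta},\quad \hat\theta^i_t=\Big|\Big\langle G^i_n(x_t),\tfrac{g_t}{\|g_t\|}\Big\rangle\Big|+\hat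 b_i+\hat\sigma_i(n)\sqrt{\ln\tfrac1\delta},$$ $$\hat M_2(x_t)=M_0+10\eta\sum_{i=1}^m\frac{M_i}{\underline\alpha^i_t}+8\eta\sum_{i=1}^m\frac{(\hat\theta_t^i)^2}{(\underline\alpha_t^i)^2},\quad \gamma_t=\min\Big\{\min_{1\le i\le m}\frac{\underline\alpha^i_t}{2|\hat\theta^i_t|+\sqrt{\underline\alpha^i_tM_i}}\frac1{\|g_t\|},\frac1{\hat M_2(x_t)}\Big\}.$$ Stop if $\|g_t\|\le 3\eta/4$; otherwise $x_{t+1}=x_t-\gamma_tg_t$. The output is $x_{\hat t}$, where $\hat t$ minimizes $\|g_t\|$ over the iterations performed. **Constants.** $c=\frac12\left(\frac{l}{4L(2m+1)}\right)^m$ and $C=\frac{c}{2L^2(1+m/c)}\cdot\frac{1}{\max\{4+5Mc\eta/L^2,\;1+\sqrt{Mc\eta/(4L^2)}\}}$. **Theorem 2.** There is $\kappa>0$, depending only on $m$, the $L_i$, the $M_i$, $l$ and $\rho$, such that the following holds. Let $0<\eta\le\rho$, $\hat\delta\in(0,1)$, let $T\ge1$ be an integer with $T\ge 11\frac{B_\eta(x_0)-\min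 B_\eta}{C\eta^3}$, and $0<\delta\le\hat\delta/(mT)$. (The minimum of $B_\eta$ over $\{f^i<0,\ 1\le i\le m\}$ is attained.) (a) If for all $i\in\{0,\dots,m\}$ $$\sigma_i(n)\sqrt{1+\ln\tfrac1\delta}\le\kappa\eta^2,\qquad \hat\sigma_i(n)\sqrt{1+\ln\tfrac1\delta}\le\kappa\eta,\qquad \hat b_i\le\kappa\eta,$$ then with probability at least $1-\hat\delta$: LB-SGD stops within its $T$ allowed iterations, after at most $11\frac{B_\eta(x_0)-\min B_\eta}{C\eta^3}$ steps; the output satisfies $f^i(x_{\hat t})<0$ for $1\le i\le m$ and $\|\nabla B_\eta(x_{\hat t})\|\le\eta$; and $x_{\hat t}$ is an $\eta$-approximate KKT point, i.e. there is $\lambda\in\mathbb R^m$ with $\lambda^i\ge0$, $-f^i(x_{\hat t})\ge0$, $\lambda^i(-f^i(x_{\hat t}))\le\eta$ for $1\le i\le m$ and $\|\nabla f^0(x_{\hat t})+\sum_{i=1}^m\lambda^i\nabla f^i(x_{\hat t})\|\le\eta$. (b) For constant $\sigma_i,\hat\sigma_i$ there are $K_1,K_2>0$, depending only on $m,L_i,M_i,l,\rho,\beta,R,\sigma_i,\hat\sigma_i$,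 such that if $\hat b_i\le\kappa\eta$ for all $i$, the batch size $n=\lceil K_1(1+\ln\frac1\delta)\eta^{-4}\rceil$ and any $T$ as above with $T\le11\frac{B_\eta(x_0)-\min B_\eta}{C\eta^3}+1$ give the conclusion of (a), with at most $(m+1)nT\le K_2(1+\ln\frac1\delta)\eta^{-7}$ oracle calls in total; that is, $n=O(\eta^{-4})$ and $N=O(\eta^{-7})$ up to the factor $1+\ln\frac1\delta$. -/

import Mathlib

open MeasureTheory ProbabilityTheory

universe u v

noncomputable section

/-- Euclidean space of dimension `d`. -/
abbrev Euc (d : ℕ) : Type := EuclideanSpace ℝ (Fin d)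

/-! ### The constrained problem

The functions are `f 0, …, f m`: `f 0` is the objective and `f i.succ`, `i : Fin m`, are the
constraints `f i.succ x ≤ 0`. -/

/-- The feasible set. -/
def feasibleSet {d m : ℕ} (f : Fin (m + 1) → Euc d → ℝ) : Set (Euc d) :=
  {x | ∀ i : Fin m, f i.succ x ≤ 0}

/-- The strictly feasible points: the domain on which the log barrier is finite. -/
def strictlyFeasible {d m : ℕ} (f : Fin (m + 1) → Euc d → ℝ) : Set (Euc d) :=
  {x | ∀ i : Fin m, f i.succ x < 0}

/-- `L`-Lipschitz continuity on a set. -/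
def LipschitzOnSet {d : ℕ} (h : Euc d → ℝ) (L : ℝ) (X : Set (Euc d)) : Prop :=
  ∀ x ∈ X, ∀ y ∈ X, |h x - h y| ≤ L * ‖x - y‖

/-- `M`-smoothness on a set (quadratic upper bound). -/
def SmoothOnSet {d : ℕ} (h : Euc d → ℝ) (M : ℝ) (X : Set (Euc d)) : Prop :=
  (∀ x ∈ X, DifferentiableAt ℝ h x) ∧
  ∀ x ∈ X, ∀ y ∈ X, h x ≤ h y + inner ℝ (gradient h y) (x - y) + M / 2 * ‖x - y‖ ^ 2

/-- Extended Mangasarian-Fromovitz constraint qualification with parameters `ρ` and `l`: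
at each feasible point there is one unit direction whose inner products with the gradients of all
`ρ`-approximately active constraints exceed `l`. -/
def ExtendedMFCQ {d m : ℕ} (f : Fin (m + 1) → Euc d → ℝ) (ρ l : ℝ) : Prop :=
  ∀ x ∈ feasibleSet f, ∃ s : Euc d, ‖s‖ = 1 ∧
    ∀ i : Fin m, -f i.succ x ≤ ρ → l < inner ℝ s (gradient (f i.succ) x)

/-- The standing assumptions on the problem: bounded feasible set, Lipschitz and smooth
functions, a starting point at distance from the boundary, extended MFCQ. -/
structure ProblemAssumptions {d m : ℕ} (f : Fin (m + 1) → Euc d → ℝ) (x₀ : Euc d)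
    (L M : Fin (m + 1) → ℝ) (R β ρ l : ℝ) : Prop where
  continuous : ∀ i, Continuous (f i)
  diameter : ∀ x ∈ feasibleSet f, ∀ y ∈ feasibleSet f, ‖x - y‖ ≤ R
  lipschitz : ∀ i, LipschitzOnSet (f i) (L i) (feasibleSet f)
  smooth : ∀ i, SmoothOnSet (f i) (M i) (feasibleSet f)
  start : ∀ i : Fin m, f i.succ x₀ ≤ -β
  rho_le : ρ ≤ β / 2
  mfcq : ExtendedMFCQ f ρ l

/-- The log barrier `B_η`. -/
def logBarrier {d m : ℕ} (f : Fin (m + 1) → Euc d → ℝ) (η : ℝ) (x : Euc d) : ℝ :=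
  f 0 x + η * ∑ i : Fin m, -Real.log (-f i.succ x)

/-- The minimal value of the log barrier over its domain. -/
def barrierMin {d m : ℕ} (f : Fin (m + 1) → Euc d → ℝ) (η : ℝ) : ℝ :=
  sInf (logBarrier f η '' strictlyFeasible f)

/-- The Lagrangian. -/
def lagrangian {d m : ℕ} (f : Fin (m + 1) → Euc d → ℝ) (lam : Fin m → ℝ) (x : Euc d) : ℝ :=
  f 0 x + ∑ i : Fin m, lam i * f i.succ x

/-- `x` is an `ε`-approximate KKT point: some dual vector makes the three conditions true. -/
def IsApproxKKT {d m : ℕ} (f : Fin (m + 1) → Euc d → ℝ) (ε : ℝ) (x : Euc d) : Prop :=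
  ∃ lam : Fin m → ℝ,
    (∀ i, 0 ≤ lam i ∧ 0 ≤ -f i.succ x) ∧
    (∀ i, lam i * (-f i.succ x) ≤ ε) ∧
    ‖gradient (lagrangian f lam) x‖ ≤ ε

/-! ### The stochastic first-order oracle -/

/-- The oracle `(F i x ξ, G i x ξ)`, where `ξ` has law `ν`: unbiased sub-Gaussian values with
parameter `σ i`, and sub-Gaussian gradients with bias at most `bhat i` and parameter `σhat i`.
(The tail bounds imply the variance bounds `σ i ^ 2` and `σhat i ^ 2`.)
Only queries at feasible points are constrained. -/
structure OracleAssumptions {d m : ℕ} {Ξ : Type*} [MeasurableSpace Ξ]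
    (f : Fin (m + 1) → Euc d → ℝ) (ν : Measure Ξ)
    (F : Fin (m + 1) → Euc d → Ξ → ℝ) (G : Fin (m + 1) → Euc d → Ξ → Euc d)
    (σ σhat bhat : Fin (m + 1) → ℝ) : Prop where
  value_measurable : ∀ i, Measurable (fun p : Euc d × Ξ => F i p.1 p.2)
  grad_measurable : ∀ i, Measurable (fun p : Euc d × Ξ => G i p.1 p.2)
  value_integrable : ∀ i, ∀ x ∈ feasibleSet f, Integrable (F i x) ν
  grad_integrable : ∀ i, ∀ x ∈ feasibleSet f, Integrable (G i x) ν
  value_unbiased : ∀ i, ∀ x ∈ feasibleSet f, ∫ z, F i x z ∂ν = f i x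
  value_tail : ∀ i, ∀ x ∈ feasibleSet f, ∀ p ∈ Set.Ioo (0 : ℝ) 1,
    1 - p ≤ ν.real {z | |F i x z - f i x| ≤ σ i * √(Real.log (1 / p))}
  grad_bias : ∀ i, ∀ x ∈ feasibleSet f, ‖(∫ z, G i x z ∂ν) - gradient (f i) x‖ ≤ bhat i
  grad_tail : ∀ i, ∀ x ∈ feasibleSet f, ∀ p ∈ Set.Ioo (0 : ℝ) 1,
    1 - p ≤ ν.real {z | ‖G i x z - ∫ z', G i x z' ∂ν‖ ≤ σhat i * √(Real.log (1 / p))}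

/-- `ξ t j` is the `j`-th sample of the batch drawn at iteration `t`; all are i.i.d. of law `ν`. -/
structure IsSampleStream {Ξ Ω : Type*} [MeasurableSpace Ξ] [MeasurableSpace Ω]
    (ν : Measure Ξ) (μ : Measure Ω) {n : ℕ} (ξ : ℕ → Fin n → Ω → Ξ) : Prop where
  measurable : ∀ t j, Measurable (ξ t j)
  indep : iIndepFun (fun p : ℕ × Fin n => ξ p.1 p.2) μ
  law : ∀ t j, μ.map (ξ t j) = ν

/-! ### The algorithm LB-SGD -/

/-- The input of LB-SGD, except for the bound on the number of iterations: starting point,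
oracle, smoothness constants, noise and bias levels, barrier parameter, batch size, confidence
parameter. -/
structure LBSGD (d m : ℕ) (Ξ : Type*) where
  x₀ : Euc d
  F : Fin (m + 1) → Euc d → Ξ → ℝ
  G : Fin (m + 1) → Euc d → Ξ → Euc d
  M : Fin (m + 1) → ℝ
  σ : Fin (m + 1) → ℝ
  σhat : Fin (m + 1) → ℝ
  bhat : Fin (m + 1) → ℝ
  η : ℝ
  n : ℕ
  δ : ℝ

namespace LBSGD

variable {d m : ℕ} {Ξ : Type*} (A : LBSGD d m Ξ)

/-- Noise level `σ_i(n) = σ_i / √n` of the batch mean of values. -/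
def σn (i : Fin (m + 1)) : ℝ := A.σ i / √(A.n : ℝ)

/-- Noise level `σhat_i(n) = σhat_i / √n` of the batch mean of gradients. -/
def σhatn (i : Fin (m + 1)) : ℝ := A.σhat i / √(A.n : ℝ)

/-- Batch mean of the value measurements at `x`. -/
def Fn (i : Fin (m + 1)) (x : Euc d) (z : Fin A.n → Ξ) : ℝ :=
  (A.n : ℝ)⁻¹ * ∑ j, A.F i x (z j)

/-- Batch mean of the gradient measurements at `x`. -/
def Gn (i : Fin (m + 1)) (x : Euc d) (z : Fin A.n → Ξ) : Euc d :=
  (A.n : ℝ)⁻¹ • ∑ j, A.G i x (z j)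

/-- The estimator `g` of the gradient of the log barrier. -/
def g (x : Euc d) (z : Fin A.n → Ξ) : Euc d :=
  A.Gn 0 x z + A.η • ∑ i : Fin m, (-A.Fn i.succ x z)⁻¹ • A.Gn i.succ x z

/-- Lower confidence bound on `-f i.succ x`. -/
def αlow (i : Fin m) (x : Euc d) (z : Fin A.n → Ξ) : ℝ :=
  -A.Fn i.succ x z - A.σn i.succ * √(Real.log (1 / A.δ))

/-- Upper confidence bound on the slope of `f i.succ` in the direction of `g`. -/
def θhat (i : Fin m) (x : Euc d) (z : Fin A.n → Ξ) : ℝ :=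
  |inner ℝ (A.Gn i.succ x z) (‖A.g x z‖⁻¹ • A.g x z)| + A.bhat i.succ
    + A.σhatn i.succ * √(Real.log (1 / A.δ))

/-- Upper bound on the local smoothness constant of the log barrier. -/
def M2hat (x : Euc d) (z : Fin A.n → Ξ) : ℝ :=
  A.M 0 + 10 * A.η * ∑ i : Fin m, A.M i.succ / A.αlow i x z
    + 8 * A.η * ∑ i : Fin m, A.θhat i x z ^ 2 / A.αlow i x z ^ 2

/-- The adaptive step size. -/
def γ (x : Euc d) (z : Fin A.n → Ξ) : ℝ :=
  min ((⨅ i : Fin m, A.αlow i x z / (2 * |A.θhat i x z| + √(A.αlow i x z * A.M i.succ)))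
      * (1 / ‖A.g x z‖))
    (1 / A.M2hat x z)

/-- The iterates, driven by the batches `z t`. The recursion is written without the stopping rule,
which only decides where a run ends. -/
def iterate (z : ℕ → Fin A.n → Ξ) : ℕ → Euc d
  | 0 => A.x₀
  | t + 1 => iterate z t - A.γ (iterate z t) (z t) • A.g (iterate z t) (z t)

/-- The gradient estimate computed at iteration `t`. -/
def gAt (z : ℕ → Fin A.n → Ξ) (t : ℕ) : Euc d := A.g (A.iterate z t) (z t)

/-- The stopping criterion `‖g_t‖ ≤ 3η/4` is met for the first time at `t = k`, so that the run
makes `k` steps and draws `k + 1` batches (at `x_0, …, x_k`). -/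
def StopsAt (z : ℕ → Fin A.n → Ξ) (k : ℕ) : Prop :=
  ‖A.gAt z k‖ ≤ 3 * A.η / 4 ∧ ∀ t < k, 3 * A.η / 4 < ‖A.gAt z t‖

/-- For a run that stops at `k`, the output is `x_j` with `j` minimizing `‖g_t‖` over the run. -/
def IsOutputIndex (z : ℕ → Fin A.n → Ξ) (k j : ℕ) : Prop :=
  j ≤ k ∧ ∀ t ≤ k, ‖A.gAt z j‖ ≤ ‖A.gAt z t‖

end LBSGD

/-- Number of single oracle queries `(F i x ξ, G i x ξ)`, over all `i = 0, …, m`, made when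
`p` batches of size `n` are drawn. -/
def oracleCalls (m n p : ℕ) : ℕ := (m + 1) * n * p

/-! ### The constants -/

/-- The constant `c` of the distance kept from the boundary, with `L = max_i L_i`. -/
def distConst {m : ℕ} (L : Fin (m + 1) → ℝ) (l : ℝ) : ℝ :=
  1 / 2 * (l / (4 * (⨆ i, L i) * (2 * m + 1))) ^ m

/-- The constant `C` of the lower bound `C η` on the step sizes, with `L = max_i L_i`,
`M = max_i M_i`. -/
def stepConst {m : ℕ} (L M : Fin (m + 1) → ℝ) (l η : ℝ) : ℝ :=
  distConst L l / (2 * (⨆ i, L i) ^ 2 * (1 + m / distConst L l)) *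
    (1 / max (4 + 5 * (⨆ i, M i) * distConst L l * η / (⨆ i, L i) ^ 2)
      (1 + √((⨆ i, M i) * distConst L l * η / (4 * (⨆ i, L i) ^ 2))))

/-- The bound `11 (B_η(x₀) - min B_η) / (C η³)` on the number of iterations. -/
def iterBound {d m : ℕ} (f : Fin (m + 1) → Euc d → ℝ) (x₀ : Euc d) (L M : Fin (m + 1) → ℝ)
    (l η : ℝ) : ℝ :=
  11 * (logBarrier f η x₀ - barrierMin f η) / (stepConst L M l η * η ^ 3)

/-- The hypotheses on a run of LB-SGD with at most `T` iterations and target failure probability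
`δhat`: the assumptions on the problem, the oracle and the samples, and the ranges of the
parameters. The smallness of the noise is not part of it. -/
structure RunAssumptions {d m : ℕ} {Ξ Ω : Type*} [MeasurableSpace Ξ] [MeasurableSpace Ω]
    (A : LBSGD d m Ξ) (f : Fin (m + 1) → Euc d → ℝ) (ν : Measure Ξ) (μ : Measure Ω)
    (ξ : ℕ → Fin A.n → Ω → Ξ) (L : Fin (m + 1) → ℝ) (R β ρ l : ℝ) (T : ℕ) (δhat : ℝ) : Prop where
  problem : ProblemAssumptions f A.x₀ L A.M R β ρ l
  oracle : OracleAssumptions f ν A.F A.G A.σ A.σhat A.bhat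
  samples : IsSampleStream ν μ ξ
  noise_nonneg : ∀ i, 0 ≤ A.σ i ∧ 0 ≤ A.σhat i ∧ 0 ≤ A.bhat i
  η_pos : 0 < A.η
  η_le : A.η ≤ ρ
  n_pos : 0 < A.n
  δhat_mem : δhat ∈ Set.Ioo (0 : ℝ) 1
  δ_pos : 0 < A.δ
  δ_le : A.δ ≤ δhat / (m * T)
  T_pos : 0 < T
  T_ge : iterBound f A.x₀ L A.M l A.η ≤ T

/-- The conclusion about a run: the minimum in the iteration bound is attained, and there is an
event of probability at least `1 - δhat` on which the run stops, within the allowed `T` iterations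
and after at most `11 (B_η(x₀) - min B_η) / (C η³)` steps, with an output at which the gradient of
the log barrier has norm at most `η` and which is an `η`-approximate KKT point. -/
def RunConclusion {d m : ℕ} {Ξ Ω : Type*} [MeasurableSpace Ω]
    (A : LBSGD d m Ξ) (f : Fin (m + 1) → Euc d → ℝ) (μ : Measure Ω)
    (ξ : ℕ → Fin A.n → Ω → Ξ) (L : Fin (m + 1) → ℝ) (l : ℝ) (T : ℕ) (δhat : ℝ) : Prop :=
  (∃ x ∈ strictlyFeasible f, IsMinOn (logBarrier f A.η) (strictlyFeasible f) x) ∧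
  ∃ S : Set Ω, MeasurableSet S ∧ 1 - δhat ≤ μ.real S ∧ ∀ ω ∈ S,
    ∃ k < T, A.StopsAt (fun t j => ξ t j ω) k ∧
      (k : ℝ) ≤ iterBound f A.x₀ L A.M l A.η ∧
      ∀ j, A.IsOutputIndex (fun t j => ξ t j ω) k j →
        A.iterate (fun t j => ξ t j ω) j ∈ strictlyFeasible f ∧
        ‖gradient (logBarrier f A.η) (A.iterate (fun t j => ξ t j ω) j)‖ ≤ A.η ∧
        IsApproxKKT f A.η (A.iterate (fun t j => ξ t j ω) j)

end

/-!
The proof has a probabilistic and a deterministic half.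

*Concentration.* In an inner product space `cosh ‖s + x‖` is bounded by a term linear in `x` plus
`cosh ‖s‖ * (exp ‖x‖ - 1 - ‖x‖)` (`cosh_norm_add_le`). The linear term vanishes in expectation, so
that each independent centred sub-Gaussian vector multiplies the expectation of `cosh (l * ‖·‖)` by
`exp (9 l² σ²)`, whatever the dimension (`measure_norm_sum_gt_le`). The iterate `x_t` is independent
of the batch drawn at time `t`, so by Fubini and a union bound all batches at feasible iterates are
accurate, with errors `O(κ η²)` for values and `O(κ η)` for gradients, outside an event of
probability `m T δ ≤ δhat` (`LBSGD.exists_accurate_event`).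

*One step.* The adaptive step size keeps at least `2 / 5` of every slack `-f i.succ x`, and the
smoothness bound gives a quadratic upper model for each term of the barrier
(`IsSafeStep.neg_log_next`). Summed over all terms this is the descent of the barrier
(`IsSafeStep.logBarrier_next`). Summed over a group `S` of constraints it says that the product of
the slacks in `S` does not decrease whenever the part of `g` that comes from `S` dominates the rest
(`IsSafeStep.sum_log_next`).

*Distance to the boundary.* With `E² = 4 L (2 m + 1) / l`, every product of `k` rescaled slacks
`-f i.succ x / η` stays above `E ^ (-k (2 m + 1 - k))` (`SlackProducts.next`). For a group near this
bound the slacks inside are small compared with those outside, so by MFCQ the group dominates and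
its product does not decrease. For `k = 1` the bound is `2 c`, where `c` is `distConst`. Hence the
slacks are at least `2 c η`, which makes the step size at least `9 / 10 * C η` and the decrease of
the barrier at least `C η³ / 10` per step until the stopping criterion holds
(`LBSGD.IsAccurate.step`). The total decrease is at most `B_η(x₀) - min B_η`, and this bounds the
number of steps. At the output `g` is small and close to the gradient of the barrier, so that
`λ i = η / (-f i.succ x)` are approximate KKT multipliers.
-/

/-! ### Dimension-free concentration of sums of independent vectors -/

/-- The power series of `cosh √y` in `y` has nonnegative coefficients. -/
lemma convexOn_cosh_sqrt : ConvexOn ℝ (Set.Ici 0) fun y : ℝ => Real.cosh √y := by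
  have hs : ∀ y : ℝ, 0 ≤ y →
      HasSum (fun n : ℕ => y ^ n / ((2 * n).factorial : ℝ)) (Real.cosh √y) := by
    intro y hy
    have h := Real.hasSum_cosh √y
    simpa only [pow_mul, Real.sq_sqrt hy] using h
  refine ⟨convex_Ici 0, fun x hx y hy a b ha hb hab => ?_⟩
  have hx' : (0 : ℝ) ≤ x := hx
  have hy' : (0 : ℝ) ≤ y := hy
  refine hasSum_le (fun n => ?_) (hs _ (by simp only [smul_eq_mul]; positivity))
    (((hs x hx).mul_left a).add ((hs y hy).mul_left b))
  have h := (convexOn_pow (𝕜 := ℝ) n).2 hx hy ha hb hab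
  simp only [smul_eq_mul] at h ⊢
  calc _ ≤ (a * x ^ n + b * y ^ n) / ((2 * n).factorial : ℝ) := by gcongr
    _ = _ := by ring

/-- A second-order bound on `cosh ‖·‖` around `s` with a remainder that depends on `x` only through
`‖x‖`. In an inner product space `‖s + x‖ ^ 2` interpolates linearly between the squares of the
collinear cases `‖s‖ + ‖x‖` and `‖s‖ - ‖x‖`. -/
lemma cosh_norm_add_le {E : Type*} [NormedAddCommGroup E] [InnerProductSpace ℝ E] (s x : E) :
    Real.cosh ‖s + x‖ ≤ Real.cosh ‖s‖ + Real.sinh ‖s‖ / ‖s‖ * inner ℝ s x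
      + Real.cosh ‖s‖ * (Real.exp ‖x‖ - 1 - ‖x‖) := by
  set a := ‖s‖ with ha
  set b := ‖x‖ with hb
  have ha0 : 0 ≤ a := norm_nonneg s
  have hb0 : 0 ≤ b := norm_nonneg x
  have hexp : Real.exp b = Real.cosh b + Real.sinh b := (Real.cosh_add_sinh b).symm
  have hshb : b ≤ Real.sinh b := Real.self_le_sinh_iff.2 hb0
  have hsa : 0 ≤ Real.sinh a := Real.sinh_nonneg_iff.2 ha0
  have hsac : Real.sinh a ≤ Real.cosh a := (Real.sinh_lt_cosh a).le
  obtain ⟨τ, hτ, hin⟩ : ∃ τ : ℝ, |τ| ≤ 1 ∧ inner ℝ s x = a * b * τ := by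
    rcases eq_or_ne (a * b) 0 with h0 | h0
    · refine ⟨0, by simp, ?_⟩
      have := abs_real_inner_le_norm s x
      rw [← ha, ← hb, h0] at this
      simpa using abs_nonpos_iff.1 this
    · refine ⟨inner ℝ s x / (a * b), abs_real_inner_div_norm_mul_norm_le_one s x, ?_⟩
      rw [mul_div_cancel₀ _ h0]
  have hτ1 := (abs_le.1 hτ).1
  have hτ2 := (abs_le.1 hτ).2
  have hsq : ‖s + x‖ = √((1 + τ) / 2 * (a + b) ^ 2 + (1 - τ) / 2 * (a - b) ^ 2) := by
    rw [eq_comm, Real.sqrt_eq_iff_mul_self_eq (by nlinarith [sq_nonneg (a+b), sq_nonneg (a-b)])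
      (norm_nonneg _), ← sq, norm_add_sq_real, hin]
    ring
  have hconv := (And.right convexOn_cosh_sqrt) (Set.mem_Ici.2 (sq_nonneg (a + b)))
    (Set.mem_Ici.2 (sq_nonneg (a - b))) (show 0 ≤ (1 + τ) / 2 by linarith)
    (show 0 ≤ (1 - τ) / 2 by linarith) (by ring)
  simp only [smul_eq_mul, Real.sqrt_sq_eq_abs, Real.cosh_abs] at hconv
  rw [← hsq, Real.cosh_add, Real.cosh_sub] at hconv
  have hlin : Real.sinh a / a * inner ℝ s x = τ * b * Real.sinh a := by
    rcases eq_or_ne a 0 with h0 | h0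
    · simp [h0]
    · rw [hin]; field_simp
  rw [hlin, hexp]
  have h1 : 0 ≤ Real.cosh a - τ * Real.sinh a := by nlinarith
  nlinarith [mul_nonneg h1 (sub_nonneg.2 hshb)]

/-- A sub-Gaussian tail bounds an exponential square moment. -/
lemma lintegral_exp_sq_le_two {Ω E : Type*} [MeasurableSpace Ω] {μ : Measure Ω}
    [IsProbabilityMeasure μ] [NormedAddCommGroup E] [MeasurableSpace E] [BorelSpace E]
    {X : Ω → E} (hX : Measurable X) {σ : ℝ} (hσ : 0 < σ)
    (tail : ∀ p ∈ Set.Ioo (0 : ℝ) 1, 1 - p ≤ μ.real {ω | ‖X ω‖ ≤ σ * √(Real.log (1 / p))}) :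
    ∫⁻ ω, ENNReal.ofReal (Real.exp (‖X ω‖ ^ 2 / (2 * σ ^ 2))) ∂μ ≤ 2 := by
  rw [lintegral_eq_lintegral_meas_lt μ (Filter.Eventually.of_forall fun _ => (Real.exp_pos _).le)
    (by fun_prop)]
  have hsplit : Set.Ioi (0 : ℝ) = Set.Ioc 0 1 ∪ Set.Ioi 1 :=
    (Set.Ioc_union_Ioi_eq_Ioi zero_le_one).symm
  rw [hsplit]
  refine (lintegral_union_le _ _ _).trans ?_
  rw [← one_add_one_eq_two (R := ENNReal)]
  refine add_le_add (α := ENNReal) ?_ ?_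
  · calc _ ≤ ∫⁻ _ in Set.Ioc (0 : ℝ) 1, (1 : ENNReal) := lintegral_mono fun t => prob_le_one
      _ = 1 := by simp
  · have key : ∀ t ∈ Set.Ioi (1 : ℝ), μ {ω | t < Real.exp (‖X ω‖ ^ 2 / (2 * σ ^ 2))} ≤
        ENNReal.ofReal (t ^ (-2 : ℝ)) := by
      intro t ht
      have ht1 : (1 : ℝ) < t := ht
      have ht0 : (0 : ℝ) < t := by linarith
      have hp : t ^ (-2 : ℝ) ∈ Set.Ioo (0 : ℝ) 1 :=
        ⟨Real.rpow_pos_of_pos ht0 _, Real.rpow_lt_one_of_one_lt_of_neg ht1 (by norm_num)⟩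
      have hlog : Real.log (1 / t ^ (-2 : ℝ)) = 2 * Real.log t := by
        rw [one_div, Real.log_inv, Real.log_rpow ht0]; ring
      have h := tail _ hp
      rw [hlog] at h
      have hmeas : MeasurableSet {ω | ‖X ω‖ ≤ σ * √(2 * Real.log t)} :=
        measurableSet_le hX.norm measurable_const
      have hsub : {ω | t < Real.exp (‖X ω‖ ^ 2 / (2 * σ ^ 2))} ⊆
          {ω | ‖X ω‖ ≤ σ * √(2 * Real.log t)}ᶜ := by
        intro ω hω hle
        simp only [Set.mem_ofPred_eq] at hω hle
        rw [← Real.log_lt_iff_lt_exp ht0, lt_div_iff₀ (by positivity)] at hω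
        have : ‖X ω‖ ^ 2 ≤ (σ * √(2 * Real.log t)) ^ 2 := by gcongr
        rw [mul_pow, Real.sq_sqrt (by have := Real.log_pos ht1; positivity)] at this
        linarith
      refine (measure_mono hsub).trans ?_
      rw [← ofReal_measureReal, probReal_compl_eq_one_sub hmeas]
      exact ENNReal.ofReal_le_ofReal (by linarith)
    calc _ ≤ ∫⁻ t in Set.Ioi (1 : ℝ), ENNReal.ofReal (t ^ (-2 : ℝ)) :=
          setLIntegral_mono' measurableSet_Ioi key
      _ = ENNReal.ofReal (∫ t in Set.Ioi (1 : ℝ), t ^ (-2 : ℝ)) := by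
          rw [ofReal_integral_eq_lintegral_ofReal
            (integrableOn_Ioi_rpow_of_lt (by norm_num) one_pos)]
          filter_upwards [ae_restrict_mem measurableSet_Ioi] with t ht
          exact Real.rpow_nonneg (zero_le_one.trans (le_of_lt ht)) _
      _ = 1 := by
          rw [integral_Ioi_rpow_of_lt (by norm_num) one_pos]; norm_num

lemma exp_sub_self_le {l z : ℝ} (hl : 0 ≤ l) (hz : 0 ≤ z) :
    Real.exp (l * z) - l * z ≤ 1 + 4 * l ^ 2 * Real.exp (l ^ 2) * Real.exp (z ^ 2 / 2) := by
  have h1 : ∀ y : ℝ, 0 ≤ y → Real.exp y - y ≤ 1 + y ^ 2 * Real.exp y := by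
    intro y hy
    have h := Real.one_sub_le_exp_neg y
    have h5 : Real.exp y * Real.exp (-y) = 1 := by rw [← Real.exp_add]; simp
    have h6 := Real.exp_pos y
    have h7 : Real.exp y - 1 ≤ y * Real.exp y := by
      nlinarith [mul_le_mul_of_nonneg_left h h6.le]
    nlinarith [mul_le_mul_of_nonneg_left h7 hy]
  have hy : 0 ≤ l * z := mul_nonneg hl hz
  refine (h1 _ hy).trans ?_
  have h2 : Real.exp (l * z) ≤ Real.exp (l ^ 2) * Real.exp (z ^ 2 / 4) := by
    rw [← Real.exp_add]; gcongr; nlinarith [sq_nonneg (l - z / 2)]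
  have h3 : z ^ 2 ≤ 4 * Real.exp (z ^ 2 / 4) := by
    have := Real.add_one_le_exp (z ^ 2 / 4); linarith
  have h4 : Real.exp (z ^ 2 / 4) * Real.exp (z ^ 2 / 4) = Real.exp (z ^ 2 / 2) := by
    rw [← Real.exp_add]; ring_nf
  calc 1 + (l * z) ^ 2 * Real.exp (l * z)
      = 1 + l ^ 2 * (z ^ 2 * Real.exp (l * z)) := by ring
    _ ≤ 1 + l ^ 2 * (4 * Real.exp (z ^ 2 / 4) *
          (Real.exp (l ^ 2) * Real.exp (z ^ 2 / 4))) := by gcongr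
    _ = 1 + 4 * l ^ 2 * Real.exp (l ^ 2) * Real.exp (z ^ 2 / 2) := by rw [← h4]; ring

/-- Adding an independent centred vector multiplies the expectation of `cosh (l * ‖·‖)` by at most
`exp (9 * l ^ 2 * σ ^ 2)`, whatever the dimension. -/
lemma lintegral_cosh_norm_add_le {Ω E : Type*} [MeasurableSpace Ω] {μ : Measure Ω}
    [IsProbabilityMeasure μ] [NormedAddCommGroup E] [InnerProductSpace ℝ E] [CompleteSpace E]
    [MeasurableSpace E] [BorelSpace E]
    {X : Ω → E} (hX : Measurable X) (hint : Integrable X μ) (hmean : ∫ ω, X ω ∂μ = 0)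
    {σ l : ℝ} (hσ : 0 < σ) (hl : 0 ≤ l)
    (hexp : ∫⁻ ω, ENNReal.ofReal (Real.exp (‖X ω‖ ^ 2 / (2 * σ ^ 2))) ∂μ ≤ 2) (s : E) :
    ∫⁻ ω, ENNReal.ofReal (Real.cosh (l * ‖s + X ω‖)) ∂μ ≤
      ENNReal.ofReal (Real.exp (9 * (l * σ) ^ 2)) * ENNReal.ofReal (Real.cosh (l * ‖s‖)) := by
  have hWint : Integrable (fun ω => Real.exp (‖X ω‖ ^ 2 / (2 * σ ^ 2))) μ := by
    refine ⟨(by fun_prop : Measurable _).aestronglyMeasurable, ?_⟩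
    rw [hasFiniteIntegral_iff_ofReal (Filter.Eventually.of_forall fun _ => (Real.exp_pos _).le)]
    exact hexp.trans_lt (by simp)
  have hW2 : ∫ ω, Real.exp (‖X ω‖ ^ 2 / (2 * σ ^ 2)) ∂μ ≤ 2 := by
    rw [integral_eq_lintegral_of_nonneg_ae
      (Filter.Eventually.of_forall fun _ => (Real.exp_pos _).le) hWint.1]
    exact ENNReal.toReal_le_of_le_ofReal (by norm_num) (by simpa using hexp)
  set K : ℝ := 4 * (l * σ) ^ 2 * Real.exp ((l * σ) ^ 2) with hK
  have hpt : ∀ ω, Real.cosh (l * ‖s + X ω‖) ≤ Real.cosh (l * ‖s‖)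
      + Real.sinh (l * ‖s‖) / (l * ‖s‖) * l ^ 2 * inner ℝ s (X ω)
      + Real.cosh (l * ‖s‖) * (K * Real.exp (‖X ω‖ ^ 2 / (2 * σ ^ 2))) := by
    intro ω
    have h := cosh_norm_add_le (l • s) (l • X ω)
    rw [← smul_add, norm_smul, norm_smul, norm_smul, Real.norm_of_nonneg hl, inner_smul_left,
      inner_smul_right] at h
    have h2 := exp_sub_self_le (l := l * σ) (z := ‖X ω‖ / σ) (by positivity) (by positivity)
    have e1 : l * σ * (‖X ω‖ / σ) = l * ‖X ω‖ := by field_simp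
    have e2 : (‖X ω‖ / σ) ^ 2 / 2 = ‖X ω‖ ^ 2 / (2 * σ ^ 2) := by field_simp
    rw [e1, e2, ← hK] at h2
    have h3 := mul_le_mul_of_nonneg_left h2 (Real.cosh_pos (l * ‖s‖)).le
    simp only [conj_trivial] at h
    nlinarith
  have hin : Integrable (fun ω => inner ℝ s (X ω)) μ := hint.const_inner s
  have hrhs : Integrable (fun ω => Real.cosh (l * ‖s‖)
      + Real.sinh (l * ‖s‖) / (l * ‖s‖) * l ^ 2 * inner ℝ s (X ω)
      + Real.cosh (l * ‖s‖) * (K * Real.exp (‖X ω‖ ^ 2 / (2 * σ ^ 2)))) μ :=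
    ((integrable_const _).add (hin.const_mul _)).add ((hWint.const_mul _).const_mul _)
  have hval : ∫ ω, (Real.cosh (l * ‖s‖)
      + Real.sinh (l * ‖s‖) / (l * ‖s‖) * l ^ 2 * inner ℝ s (X ω)
      + Real.cosh (l * ‖s‖) * (K * Real.exp (‖X ω‖ ^ 2 / (2 * σ ^ 2)))) ∂μ
      ≤ Real.exp (9 * (l * σ) ^ 2) * Real.cosh (l * ‖s‖) := by
    rw [integral_add (f := fun ω => Real.cosh (l * ‖s‖)
      + Real.sinh (l * ‖s‖) / (l * ‖s‖) * l ^ 2 * inner ℝ s (X ω))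
      ((integrable_const _).add (hin.const_mul _)) ((hWint.const_mul _).const_mul _),
      integral_add (integrable_const _) (hin.const_mul _),
      integral_const_mul, integral_const_mul, integral_const_mul, integral_inner hint, hmean]
    simp only [integral_const, inner_zero_right, mul_zero, add_zero, probReal_univ, one_smul]
    have hc := Real.cosh_pos (l * ‖s‖)
    have hK0 : 0 ≤ K := by positivity
    have h9 : 1 + K * 2 ≤ Real.exp (9 * (l * σ) ^ 2) := by
      have e : Real.exp (9 * (l * σ) ^ 2) =
          Real.exp ((l * σ) ^ 2) * Real.exp (8 * (l * σ) ^ 2) := by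
        rw [← Real.exp_add]; ring_nf
      have h1 := Real.add_one_le_exp (8 * (l * σ) ^ 2)
      have h2 : 1 ≤ Real.exp ((l * σ) ^ 2) := Real.one_le_exp (sq_nonneg _)
      rw [e]
      nlinarith [mul_le_mul_of_nonneg_left h1 (Real.exp_pos ((l * σ) ^ 2)).le]
    have h10 := mul_le_mul_of_nonneg_left hW2 hK0
    nlinarith [mul_le_mul_of_nonneg_left (h9.trans' (add_le_add_right h10 1)) hc.le]
  rw [← ENNReal.ofReal_mul (Real.exp_pos _).le]
  refine le_trans (lintegral_mono fun ω => ENNReal.ofReal_le_ofReal (hpt ω)) ?_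
  rw [← ofReal_integral_eq_lintegral_ofReal hrhs
    (Filter.Eventually.of_forall fun ω => (Real.cosh_pos _).le.trans (hpt ω))]
  exact ENNReal.ofReal_le_ofReal hval

/-- The expectation of `cosh (l * ‖·‖)` of a sum of independent centred vectors. -/
lemma lintegral_cosh_norm_sum_le {ι Ω E : Type*} [MeasurableSpace Ω] {μ : Measure Ω}
    [IsProbabilityMeasure μ] [NormedAddCommGroup E] [InnerProductSpace ℝ E] [CompleteSpace E]
    [MeasurableSpace E] [BorelSpace E] [SecondCountableTopology E]
    {X : ι → Ω → E} (hX : ∀ j, Measurable (X j)) (hindep : iIndepFun X μ)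
    (hint : ∀ j, Integrable (X j) μ) (hmean : ∀ j, ∫ ω, X j ω ∂μ = 0)
    {σ l : ℝ} (hσ : 0 < σ) (hl : 0 ≤ l)
    (hexp : ∀ j, ∫⁻ ω, ENNReal.ofReal (Real.exp (‖X j ω‖ ^ 2 / (2 * σ ^ 2))) ∂μ ≤ 2)
    (s : Finset ι) :
    ∫⁻ ω, ENNReal.ofReal (Real.cosh (l * ‖∑ j ∈ s, X j ω‖)) ∂μ ≤
      ENNReal.ofReal (Real.exp (9 * (l * σ) ^ 2)) ^ s.card := by
  classical
  induction s using Finset.induction_on with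
  | empty => simp
  | insert i s hi ih =>
    have hS : Measurable (∑ j ∈ s, X j) := by
      simpa only [← Finset.sum_fn] using Finset.measurable_fun_sum s fun j _ => hX j
    have hind : IndepFun (∑ j ∈ s, X j) (X i) μ := hindep.indepFun_finsetSum_of_notMem hX hi
    have hlaw := (indepFun_iff_map_prod_eq_prod_map_map hS.aemeasurable (hX i).aemeasurable).1 hind
    have hm : Measurable fun p : E × E => ENNReal.ofReal (Real.cosh (l * ‖p.1 + p.2‖)) :=
      (Real.measurable_cosh.comp
        (((measurable_fst.add measurable_snd).norm).const_mul l)).ennreal_ofReal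
    have := Measure.isProbabilityMeasure_map (μ := μ) (hX i).aemeasurable
    have := Measure.isProbabilityMeasure_map (μ := μ) hS.aemeasurable
    calc ∫⁻ ω, ENNReal.ofReal (Real.cosh (l * ‖∑ j ∈ insert i s, X j ω‖)) ∂μ
        = ∫⁻ ω, ENNReal.ofReal (Real.cosh (l * ‖(∑ j ∈ s, X j) ω + X i ω‖)) ∂μ := by
          simp [Finset.sum_insert hi, add_comm]
      _ = ∫⁻ p, ENNReal.ofReal (Real.cosh (l * ‖p.1 + p.2‖))
            ∂(μ.map fun ω => ((∑ j ∈ s, X j) ω, X i ω)) :=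
          (lintegral_map hm (hS.prodMk (hX i))).symm
      _ = ∫⁻ a, ∫⁻ b, ENNReal.ofReal (Real.cosh (l * ‖a + b‖)) ∂(μ.map (X i))
            ∂(μ.map (∑ j ∈ s, X j)) := by
          rw [hlaw, lintegral_prod _ hm.aemeasurable]
      _ ≤ ∫⁻ a, ENNReal.ofReal (Real.exp (9 * (l * σ) ^ 2)) *
            ENNReal.ofReal (Real.cosh (l * ‖a‖)) ∂(μ.map (∑ j ∈ s, X j)) := by
          refine lintegral_mono fun a => ?_
          have hma : Measurable fun b : E => ENNReal.ofReal (Real.cosh (l * ‖a + b‖)) :=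
            (Real.measurable_cosh.comp
              ((measurable_id.const_add a).norm.const_mul l)).ennreal_ofReal
          rw [lintegral_map hma (hX i)]
          exact lintegral_cosh_norm_add_le (hX i) (hint i) (hmean i) hσ hl (hexp i) a
      _ = ENNReal.ofReal (Real.exp (9 * (l * σ) ^ 2)) *
            ∫⁻ ω, ENNReal.ofReal (Real.cosh (l * ‖∑ j ∈ s, X j ω‖)) ∂μ := by
          have hm' : Measurable fun a : E => ENNReal.ofReal (Real.cosh (l * ‖a‖)) :=
            (Real.measurable_cosh.comp (measurable_norm.const_mul l)).ennreal_ofReal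
          rw [lintegral_const_mul _ hm', lintegral_map hm' hS]
          simp
      _ ≤ _ := by
          rw [Finset.card_insert_of_notMem hi, pow_succ' _ s.card]
          exact mul_le_mul' le_rfl ih

/-- Dimension-free sub-Gaussian concentration for a sum of independent centred vectors. -/
lemma measure_norm_sum_gt_le {ι Ω E : Type*} [MeasurableSpace Ω] {μ : Measure Ω}
    [IsProbabilityMeasure μ] [NormedAddCommGroup E] [InnerProductSpace ℝ E] [CompleteSpace E]
    [MeasurableSpace E] [BorelSpace E] [SecondCountableTopology E] [Fintype ι] [Nonempty ι]
    {X : ι → Ω → E} (hX : ∀ j, Measurable (X j)) (hindep : iIndepFun X μ)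
    (hint : ∀ j, Integrable (X j) μ) (hmean : ∀ j, ∫ ω, X j ω ∂μ = 0)
    {σ : ℝ} (hσ : 0 < σ)
    (tail : ∀ j, ∀ p ∈ Set.Ioo (0 : ℝ) 1,
      1 - p ≤ μ.real {ω | ‖X j ω‖ ≤ σ * √(Real.log (1 / p))}) {s : ℝ} (hs : 0 ≤ s) :
    μ {ω | 11 * σ * √(Fintype.card ι) * s < ‖∑ j, X j ω‖} ≤
      ENNReal.ofReal (2 * Real.exp (-2 * s ^ 2)) := by
  have hn : (0 : ℝ) < √(Fintype.card ι) := Real.sqrt_pos.2 (by exact_mod_cast Fintype.card_pos)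
  set N : ℝ := √(Fintype.card ι) with hN
  have hN2 : N ^ 2 = Fintype.card ι := Real.sq_sqrt (by positivity)
  -- Markov's inequality for `cosh (l * ‖·‖)`, with `l` of the optimal order
  set l : ℝ := s / (σ * N) with hl
  have hl0 : 0 ≤ l := by positivity
  have hlσ : l * σ = s / N := by rw [hl]; field_simp
  have hmain := lintegral_cosh_norm_sum_le hX hindep hint hmean hσ hl0
    (fun j => lintegral_exp_sq_le_two (hX j) hσ (tail j)) Finset.univ
  rw [← ENNReal.ofReal_pow (Real.exp_pos _).le, ← Real.exp_nat_mul, Finset.card_univ, ← hN2, hlσ]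
    at hmain
  have e9 : N ^ 2 * (9 * (s / N) ^ 2) = 9 * s ^ 2 := by field_simp
  rw [e9] at hmain
  have hmeas : Measurable fun ω => ENNReal.ofReal (Real.cosh (l * ‖∑ j, X j ω‖)) :=
    (Real.measurable_cosh.comp
      (((Finset.measurable_fun_sum _ fun j _ => hX j).norm).const_mul l)).ennreal_ofReal
  have hsub : {ω | 11 * σ * N * s < ‖∑ j, X j ω‖} ⊆
      {ω | ENNReal.ofReal (Real.exp (11 * s ^ 2) / 2) ≤
        ENNReal.ofReal (Real.cosh (l * ‖∑ j, X j ω‖))} := by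
    intro ω hω
    refine ENNReal.ofReal_le_ofReal ?_
    have h1 : 11 * s ^ 2 ≤ l * ‖∑ j, X j ω‖ := by
      calc 11 * s ^ 2 = l * (11 * σ * N * s) := by rw [hl]; field_simp
        _ ≤ _ := mul_le_mul_of_nonneg_left (le_of_lt hω) hl0
    rw [Real.cosh_eq]
    have := Real.exp_le_exp.2 h1
    have := Real.exp_pos (-(l * ‖∑ j, X j ω‖))
    linarith
  have hpos : 0 < Real.exp (11 * s ^ 2) / 2 := by positivity
  refine (measure_mono hsub).trans ?_
  refine (meas_ge_le_lintegral_div hmeas.aemeasurable (by simpa using Real.exp_pos _)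
    ENNReal.ofReal_ne_top).trans ?_
  refine (ENNReal.div_le_div_right hmain _).trans ?_
  rw [← ENNReal.ofReal_div_of_pos hpos]
  refine ENNReal.ofReal_le_ofReal (le_of_eq ?_)
  have : Real.exp (9 * s ^ 2) = Real.exp (-2 * s ^ 2) * Real.exp (11 * s ^ 2) := by
    rw [← Real.exp_add]; ring_nf
  rw [this]; field_simp

/-- Deviation of a batch mean from its expectation. The threshold `a` may exceed the noise level
`σ / √n * √(1 + log (1 / δ))`, which covers `σ = 0`. -/
lemma measure_batch_mean_gt_le {Ξ E : Type*} [MeasurableSpace Ξ] {ν : Measure Ξ}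
    [IsProbabilityMeasure ν] [NormedAddCommGroup E] [InnerProductSpace ℝ E] [CompleteSpace E]
    [MeasurableSpace E] [BorelSpace E] [SecondCountableTopology E] {n : ℕ} (hn : 0 < n)
    {H : Ξ → E} (hH : Measurable H) (hint : Integrable H ν) {σ a δ : ℝ}
    (tail : ∀ p ∈ Set.Ioo (0 : ℝ) 1,
      1 - p ≤ ν.real {z | ‖H z - ∫ z', H z' ∂ν‖ ≤ σ * √(Real.log (1 / p))})
    (hδ : 0 < δ) (hδ1 : δ ≤ 1) (ha : 0 < a) (hσa : σ / √n * √(1 + Real.log (1 / δ)) ≤ a) :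
    (Measure.pi fun _ : Fin n => ν)
      {z | 11 * a < ‖(n : ℝ)⁻¹ • ∑ j, H (z j) - ∫ z', H z' ∂ν‖} ≤ ENNReal.ofReal (δ / 3) := by
  have hn' : (0 : ℝ) < n := by exact_mod_cast hn
  have hN : (0 : ℝ) < √n := Real.sqrt_pos.2 hn'
  have hlog : 0 ≤ Real.log (1 / δ) := Real.log_nonneg ((one_le_div hδ).2 hδ1)
  set s := √(1 + Real.log (1 / δ)) with hs
  have hs0 : 0 < s := Real.sqrt_pos.2 (by linarith)
  have hs2 : s ^ 2 = 1 + Real.log (1 / δ) := Real.sq_sqrt (by linarith)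
  -- enlarge `σ` until the hypothesis on `a` is an equality
  set σ' := a * √n / s with hσ'
  have hσ'0 : 0 < σ' := by positivity
  have hσσ' : σ ≤ σ' := by
    rw [hσ', le_div_iff₀ hs0]
    rw [div_mul_eq_mul_div, div_le_iff₀ hN] at hσa
    exact hσa
  set m := ∫ z', H z' ∂ν with hm
  have hmp := fun j : Fin n => measurePreserving_eval (fun _ : Fin n => ν) j
  have hXm : Measurable fun z => H z - m := hH.sub_const m
  have hXint : Integrable (fun z => H z - m) ν := hint.sub (integrable_const m)
  have : Nonempty (Fin n) := ⟨⟨0, hn⟩⟩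
  have key := measure_norm_sum_gt_le (μ := Measure.pi fun _ : Fin n => ν)
    (X := fun (j : Fin n) (z : Fin n → Ξ) => H (z j) - m)
    (fun j => hXm.comp (measurable_pi_apply j))
    (iIndepFun_pi (X := fun (_ : Fin n) z => H z - m) fun _ => hXm.aemeasurable)
    (fun j => (hmp j).integrable_comp_of_integrable hXint)
    (fun j => by
      have h1 := integral_map (μ := Measure.pi fun _ : Fin n => ν) (φ := Function.eval j)
        (f := fun z => H z - m) (measurable_pi_apply j).aemeasurable
        hXm.aestronglyMeasurable
      rw [(hmp j).map_eq] at h1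
      refine h1.symm.trans ?_
      rw [integral_sub hint (integrable_const m)]
      simp [hm])
    hσ'0
    (fun j p hp => by
      refine (tail p hp).trans ?_
      have hsub : {z | ‖H z - m‖ ≤ σ * √(Real.log (1 / p))} ⊆
          {z | ‖H z - m‖ ≤ σ' * √(Real.log (1 / p))} := fun z hz =>
        le_trans hz (mul_le_mul_of_nonneg_right hσσ' (Real.sqrt_nonneg _))
      refine (measureReal_mono hsub).trans (le_of_eq ?_)
      exact ((hmp j).measureReal_preimage
        (measurableSet_le hXm.norm measurable_const).nullMeasurableSet).symm)
    hs0.le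
  refine le_trans (measure_mono ?_) (key.trans (ENNReal.ofReal_le_ofReal ?_))
  · intro z hz
    simp only [Set.mem_ofPred_eq] at hz ⊢
    have e1 : ∑ j, (H (z j) - m) = (n : ℝ) • ((n : ℝ)⁻¹ • ∑ j, H (z j) - m) := by
      rw [Finset.sum_sub_distrib, smul_sub, smul_inv_smul₀ hn'.ne', Nat.cast_smul_eq_nsmul]
      simp
    have e2 : 11 * σ' * √(Fintype.card (Fin n)) * s = n * (11 * a) := by
      rw [Fintype.card_fin, hσ']
      field_simp
      rw [Real.sq_sqrt hn'.le]
    rw [e1, e2, norm_smul, Real.norm_of_nonneg hn'.le]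
    exact mul_lt_mul_of_pos_left hz hn'
  · have e : Real.exp (-2 * s ^ 2) = Real.exp (-2) * δ ^ 2 := by
      rw [hs2, one_div, Real.log_inv, ← Real.exp_log (pow_pos hδ 2), Real.log_pow, ← Real.exp_add]
      congr 1
      push_cast
      ring
    have h6 : 6 * Real.exp (-2) ≤ 1 := by
      have h1 : (2.7 : ℝ) < Real.exp 1 := lt_trans (by norm_num) Real.exp_one_gt_d9
      have h2 : Real.exp (-2) * (Real.exp 1 * Real.exp 1) = 1 := by
        rw [← Real.exp_add, ← Real.exp_add]; norm_num
      have h3 := Real.exp_pos (-2)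
      nlinarith [mul_self_nonneg (Real.exp 1 - 2.7)]
    rw [e]
    have : δ ^ 2 ≤ δ := by nlinarith
    nlinarith [Real.exp_pos (-2), sq_nonneg δ]

/-! ### Measurability and independence of the iterates -/

lemma measurable_family_of_mem {ι κ Ω Ξ : Type*} [MeasurableSpace Ξ] {ξ : ι → Ω → Ξ} {s : Set ι}
    {e : κ → ι} (he : ∀ j, e j ∈ s) :
    Measurable[⨆ p ∈ s, MeasurableSpace.comap (ξ p) inferInstance] fun ω j => ξ (e j) ω := by
  let _ : MeasurableSpace Ω := ⨆ p ∈ s, MeasurableSpace.comap (ξ p) inferInstance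
  refine measurable_pi_lambda _ fun j => (comap_measurable (ξ (e j))).mono ?_ le_rfl
  exact le_iSup₂_of_le (f := fun p (_ : p ∈ s) => MeasurableSpace.comap (ξ p) inferInstance)
    (e j) (he j) le_rfl

namespace LBSGD

variable {d m : ℕ} {Ξ : Type*} [MeasurableSpace Ξ] (A : LBSGD d m Ξ)

lemma measurable_Fn (hF : ∀ i, Measurable fun p : Euc d × Ξ => A.F i p.1 p.2) (i : Fin (m + 1)) :
    Measurable fun p : Euc d × (Fin A.n → Ξ) => A.Fn i p.1 p.2 := by
  refine (Finset.measurable_fun_sum _ fun j _ => ?_).const_mul _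
  exact (hF i).comp (measurable_fst.prodMk ((measurable_pi_apply j).comp measurable_snd))

lemma measurable_Gn (hG : ∀ i, Measurable fun p : Euc d × Ξ => A.G i p.1 p.2) (i : Fin (m + 1)) :
    Measurable fun p : Euc d × (Fin A.n → Ξ) => A.Gn i p.1 p.2 := by
  refine (Finset.measurable_fun_sum _ fun j _ => ?_).const_smul (A.n : ℝ)⁻¹
  exact (hG i).comp (measurable_fst.prodMk ((measurable_pi_apply j).comp measurable_snd))

lemma measurable_step (hF : ∀ i, Measurable fun p : Euc d × Ξ => A.F i p.1 p.2)
    (hG : ∀ i, Measurable fun p : Euc d × Ξ => A.G i p.1 p.2) :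
    Measurable fun p : Euc d × (Fin A.n → Ξ) => p.1 - A.γ p.1 p.2 • A.g p.1 p.2 := by
  have h1 := A.measurable_Fn hF
  have h2 := A.measurable_Gn hG
  have hg : Measurable fun p : Euc d × (Fin A.n → Ξ) => A.g p.1 p.2 :=
    (h2 0).add ((Finset.measurable_fun_sum _ fun i _ =>
      ((h1 i.succ).neg.inv).smul (h2 i.succ)).const_smul A.η)
  have ha : ∀ i, Measurable fun p : Euc d × (Fin A.n → Ξ) => A.αlow i p.1 p.2 := fun i =>
    (h1 i.succ).neg.sub_const _
  have hθ : ∀ i, Measurable fun p : Euc d × (Fin A.n → Ξ) => A.θhat i p.1 p.2 := fun i =>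
    ((((h2 i.succ).inner ((hg.norm.inv).smul hg)).abs).add_const _).add_const _
  have hM : Measurable fun p : Euc d × (Fin A.n → Ξ) => A.M2hat p.1 p.2 :=
    (((Finset.measurable_fun_sum _ fun i _ => (ha i).const_div _).const_mul _).const_add _).add
      ((Finset.measurable_fun_sum _ fun i _ =>
        ((hθ i).pow_const 2).div ((ha i).pow_const 2)).const_mul _)
  have hγ : Measurable fun p : Euc d × (Fin A.n → Ξ) => A.γ p.1 p.2 := by
    refine Measurable.min (Measurable.mul ?_ (hg.norm.const_div 1)) (hM.const_div 1)
    exact Measurable.iInf fun i => (ha i).div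
      (((hθ i).abs.const_mul 2).add ((ha i).mul_const _).sqrt)
  exact measurable_fst.sub (hγ.smul hg)

variable {Ω : Type*} {ξ : ℕ → Fin A.n → Ω → Ξ}

/-- The iterate `x_t` is a function of the samples drawn before iteration `t`. -/
lemma measurable_iterate (hF : ∀ i, Measurable fun p : Euc d × Ξ => A.F i p.1 p.2)
    (hG : ∀ i, Measurable fun p : Euc d × Ξ => A.G i p.1 p.2) (t : ℕ) :
    Measurable[⨆ p ∈ {p : ℕ × Fin A.n | p.1 < t}, MeasurableSpace.comap (ξ p.1 p.2) inferInstance]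
      fun ω => A.iterate (fun t j => ξ t j ω) t := by
  induction t with
  | zero => exact measurable_const
  | succ t ih =>
    refine (A.measurable_step hF hG).comp (Measurable.prodMk ?_ ?_)
    · exact ih.mono (biSup_mono fun p hp => Nat.lt_succ_of_lt hp) le_rfl
    · exact measurable_family_of_mem (ξ := fun p : ℕ × Fin A.n => ξ p.1 p.2)
        (e := fun j => (t, j)) fun j => Nat.lt_succ_self t

variable [MeasurableSpace Ω] {ν : Measure Ξ} {μ : Measure Ω}

/-- The batch drawn at iteration `t` is independent of `x_t`, so a bad event whose probability is
small for each fixed point has small probability at the random point `x_t`. -/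
lemma measure_iterate_batch_le [IsProbabilityMeasure ν] [IsProbabilityMeasure μ]
    (hF : ∀ i, Measurable fun p : Euc d × Ξ => A.F i p.1 p.2)
    (hG : ∀ i, Measurable fun p : Euc d × Ξ => A.G i p.1 p.2)
    (hξ : IsSampleStream ν μ ξ) (t : ℕ) {D : Set (Euc d × (Fin A.n → Ξ))} (hD : MeasurableSet D)
    {q : ENNReal} (hq : ∀ x, (Measure.pi fun _ : Fin A.n => ν) {z | (x, z) ∈ D} ≤ q) :
    MeasurableSet {ω | (A.iterate (fun t j => ξ t j ω) t, fun j => ξ t j ω) ∈ D} ∧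
    μ {ω | (A.iterate (fun t j => ξ t j ω) t, fun j => ξ t j ω) ∈ D} ≤ q := by
  have hle : ∀ p : ℕ × Fin A.n,
      MeasurableSpace.comap (ξ p.1 p.2) inferInstance ≤ ‹MeasurableSpace Ω› :=
    fun p => (hξ.measurable p.1 p.2).comap_le
  have hx := A.measurable_iterate (ξ := ξ) hF hG t
  have hx' : Measurable fun ω => A.iterate (fun t j => ξ t j ω) t :=
    hx.mono (iSup₂_le fun p _ => hle p) le_rfl
  have hz : Measurable fun ω => fun j => ξ t j ω := measurable_pi_lambda _ (hξ.measurable t)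
  have hz' : Measurable[⨆ p ∈ {p : ℕ × Fin A.n | p.1 = t},
      MeasurableSpace.comap (ξ p.1 p.2) inferInstance] fun ω => fun j => ξ t j ω := by
    exact measurable_family_of_mem (ξ := fun p : ℕ × Fin A.n => ξ p.1 p.2)
      (e := fun j => (t, j)) fun j => rfl
  have hdisj : Disjoint {p : ℕ × Fin A.n | p.1 < t} {p : ℕ × Fin A.n | p.1 = t} :=
    Set.disjoint_left.2 fun p hp hp' => (ne_of_lt hp) hp'
  have hind : IndepFun (fun ω => A.iterate (fun t j => ξ t j ω) t) (fun ω j => ξ t j ω) μ := by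
    have h := indep_iSup_of_disjoint hle hξ.indep hdisj
    exact indep_of_indep_of_le_left (indep_of_indep_of_le_right h hz'.comap_le) hx.comap_le
  have hlaw : μ.map (fun ω j => ξ t j ω) = Measure.pi fun _ : Fin A.n => ν := by
    have h := hξ.indep.precomp (g := fun j : Fin A.n => (t, j))
      fun a b hab => (Prod.ext_iff.1 hab).2
    refine ((iIndepFun_iff_map_fun_eq_pi_map
      (fun j => (hξ.measurable t j).aemeasurable)).1 h).trans ?_
    simp only [hξ.law]
  refine ⟨(hx'.prodMk hz) hD, ?_⟩
  have hjoint := (indepFun_iff_map_prod_eq_prod_map_map hx'.aemeasurable hz.aemeasurable).1 hind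
  have hprob := Measure.isProbabilityMeasure_map (μ := μ) hx'.aemeasurable
  calc μ {ω | (A.iterate (fun t j => ξ t j ω) t, fun j => ξ t j ω) ∈ D}
      = (μ.map fun ω => (A.iterate (fun t j => ξ t j ω) t, fun j => ξ t j ω)) D :=
        (Measure.map_apply (hx'.prodMk hz) hD).symm
    _ = ∫⁻ x, (Measure.pi fun _ : Fin A.n => ν) {z | (x, z) ∈ D}
          ∂(μ.map fun ω => A.iterate (fun t j => ξ t j ω) t) := by
        rw [hjoint, hlaw, Measure.prod_apply hD]
        rfl
    _ ≤ ∫⁻ _, q ∂(μ.map fun ω => A.iterate (fun t j => ξ t j ω) t) := lintegral_mono hq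
    _ = q := by simp

end LBSGD

/-! ### The event on which all batches are accurate -/

lemma isClosed_feasibleSet {d m : ℕ} {f : Fin (m + 1) → Euc d → ℝ} (hf : ∀ i, Continuous (f i)) :
    IsClosed (feasibleSet f) := by
  have : feasibleSet f = ⋂ i : Fin m, {x | f i.succ x ≤ 0} := by
    ext x; simp [feasibleSet]
  rw [this]
  exact isClosed_iInter fun i => isClosed_le (hf _) continuous_const

/-- With probability at least `1 - m T δ`, all batch means computed at feasible iterates before
time `T` are accurate. Each of the `2 m + 1 ≤ 3 m` deviations per iteration has probability at most
`δ / 3`. -/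
lemma LBSGD.exists_accurate_event {d m : ℕ} {Ξ Ω : Type*} [MeasurableSpace Ξ] [MeasurableSpace Ω]
    {A : LBSGD d m Ξ} {f : Fin (m + 1) → Euc d → ℝ} {ν : Measure Ξ} [IsProbabilityMeasure ν]
    {μ : Measure Ω} [IsProbabilityMeasure μ] {ξ : ℕ → Fin A.n → Ω → Ξ}
    (hm : 1 ≤ m) (hf : ∀ i, Continuous (f i))
    (hor : OracleAssumptions f ν A.F A.G A.σ A.σhat A.bhat) (hξ : IsSampleStream ν μ ξ)
    (hn : 0 < A.n) (hδ : 0 < A.δ) (hδ1 : A.δ ≤ 1) {a b : ℝ} (ha : 0 < a) (hb : 0 < b)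
    (hσ : ∀ i, A.σn i * √(1 + Real.log (1 / A.δ)) ≤ a)
    (hσh : ∀ i, A.σhatn i * √(1 + Real.log (1 / A.δ)) ≤ b) (T : ℕ) :
    ∃ S : Set Ω, MeasurableSet S ∧ 1 - m * T * A.δ ≤ μ.real S ∧ ∀ ω ∈ S, ∀ t < T,
      A.iterate (fun t j => ξ t j ω) t ∈ feasibleSet f →
        (∀ i : Fin m, |A.Fn i.succ (A.iterate (fun t j => ξ t j ω) t) (fun j => ξ t j ω)
          - f i.succ (A.iterate (fun t j => ξ t j ω) t)| ≤ 11 * a) ∧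
        ∀ i, ‖A.Gn i (A.iterate (fun t j => ξ t j ω) t) (fun j => ξ t j ω)
          - gradient (f i) (A.iterate (fun t j => ξ t j ω) t)‖ ≤ 11 * b + A.bhat i := by
  set D : Set (Euc d × (Fin A.n → Ξ)) := {p | p.1 ∈ feasibleSet f ∧
    ((∃ i : Fin m, 11 * a < ‖A.Fn i.succ p.1 p.2 - ∫ z, A.F i.succ p.1 z ∂ν‖) ∨
      ∃ i, 11 * b < ‖A.Gn i p.1 p.2 - ∫ z, A.G i p.1 z ∂ν‖)} with hD
  have hDm : MeasurableSet D := by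
    have h1 : ∀ i, Measurable fun p : Euc d × (Fin A.n → Ξ) => ∫ z, A.F i p.1 z ∂ν := fun i =>
      ((hor.value_measurable i).stronglyMeasurable.integral_prod_right
        (f := fun x z => A.F i x z)).measurable.comp measurable_fst
    have h2 : ∀ i, Measurable fun p : Euc d × (Fin A.n → Ξ) => ∫ z, A.G i p.1 z ∂ν := fun i =>
      ((hor.grad_measurable i).stronglyMeasurable.integral_prod_right
        (f := fun x z => A.G i x z)).measurable.comp measurable_fst
    refine (measurable_fst (isClosed_feasibleSet hf).measurableSet).inter
      (MeasurableSet.union ?_ ?_)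
    · exact measurableSet_setOfPred.2 <| Measurable.exists fun i => measurableSet_setOfPred.1 <|
        measurableSet_lt measurable_const
        ((A.measurable_Fn hor.value_measurable i.succ).sub (h1 i.succ)).norm
    · exact measurableSet_setOfPred.2 <| Measurable.exists fun i => measurableSet_setOfPred.1 <|
        measurableSet_lt measurable_const
        ((A.measurable_Gn hor.grad_measurable i).sub (h2 i)).norm
  have hq : ∀ x, (Measure.pi fun _ : Fin A.n => ν) {z | (x, z) ∈ D} ≤
      ENNReal.ofReal (m * A.δ) := by
    intro x
    by_cases hx : x ∈ feasibleSet f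
    · have hsub : {z | (x, z) ∈ D} ⊆
          (⋃ i : Fin m, {z | 11 * a < ‖A.Fn i.succ x z - ∫ z, A.F i.succ x z ∂ν‖}) ∪
          ⋃ i, {z | 11 * b < ‖A.Gn i x z - ∫ z, A.G i x z ∂ν‖} := by
        rintro z ⟨-, ⟨i, hi⟩ | ⟨i, hi⟩⟩
        · exact Or.inl (Set.mem_iUnion.2 ⟨i, hi⟩)
        · exact Or.inr (Set.mem_iUnion.2 ⟨i, hi⟩)
      refine (measure_mono hsub).trans ((measure_union_le _ _).trans ?_)
      have h1 : ∀ i : Fin m, (Measure.pi fun _ : Fin A.n => ν)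
          {z | 11 * a < ‖A.Fn i.succ x z - ∫ z, A.F i.succ x z ∂ν‖} ≤
          ENNReal.ofReal (A.δ / 3) := fun i =>
        measure_batch_mean_gt_le hn ((hor.value_measurable i.succ).comp measurable_prodMk_left)
          (hor.value_integrable _ x hx)
          (fun p hp => by
            have h := hor.value_tail i.succ x hx p hp
            rw [← hor.value_unbiased i.succ x hx] at h
            exact h) hδ hδ1 ha (hσ i.succ)
      have h2 : ∀ i, (Measure.pi fun _ : Fin A.n => ν)
          {z | 11 * b < ‖A.Gn i x z - ∫ z, A.G i x z ∂ν‖} ≤ ENNReal.ofReal (A.δ / 3) := fun i =>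
        measure_batch_mean_gt_le hn ((hor.grad_measurable i).comp measurable_prodMk_left)
          (hor.grad_integrable _ x hx) (hor.grad_tail i x hx) hδ hδ1 hb (hσh i)
      refine (add_le_add ((measure_iUnion_fintype_le _ _).trans (Finset.sum_le_sum fun i _ => h1 i))
        ((measure_iUnion_fintype_le _ _).trans (Finset.sum_le_sum fun i _ => h2 i))).trans ?_
      have hm' : (1 : ℝ) ≤ m := by exact_mod_cast hm
      rw [Finset.sum_const, Finset.sum_const, Finset.card_fin, Finset.card_fin, ← add_smul,
        nsmul_eq_mul, ← ENNReal.ofReal_natCast, ← ENNReal.ofReal_mul (by positivity)]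
      refine ENNReal.ofReal_le_ofReal ?_
      push_cast
      nlinarith
    · have : {z | (x, z) ∈ D} = ∅ := by
        ext z
        simp [hD, hx]
      rw [this]; simp
  have hbad := fun t => A.measure_iterate_batch_le hor.value_measurable hor.grad_measurable hξ t
    hDm hq
  set B : ℕ → Set Ω := fun t =>
    {ω | (A.iterate (fun t j => ξ t j ω) t, fun j => ξ t j ω) ∈ D} with hB
  have hBm : MeasurableSet (⋃ t ∈ Finset.range T, B t) :=
    Finset.measurableSet_biUnion _ fun t _ => (hbad t).1
  refine ⟨(⋃ t ∈ Finset.range T, B t)ᶜ, hBm.compl, ?_, ?_⟩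
  · rw [probReal_compl_eq_one_sub hBm]
    have h1 : μ.real (⋃ t ∈ Finset.range T, B t) ≤ ∑ _t ∈ Finset.range T, m * A.δ := by
      refine (measureReal_biUnion_finset_le _ _).trans (Finset.sum_le_sum fun t _ => ?_)
      exact ENNReal.toReal_le_of_le_ofReal (by positivity) (hbad t).2
    rw [Finset.sum_const, Finset.card_range, nsmul_eq_mul] at h1
    linarith
  · intro ω hω t ht hfeas
    have hnot : ω ∉ B t := fun h =>
      hω (Set.mem_biUnion (Finset.mem_coe.2 (Finset.mem_range.2 ht)) h)
    have hnot' : ¬ (_ ∨ _) := fun h => hnot ⟨hfeas, h⟩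
    obtain ⟨h1, h2⟩ := not_or.1 hnot'
    push Not at h1 h2
    refine ⟨fun i => ?_, fun i => ?_⟩
    · rw [← hor.value_unbiased i.succ _ hfeas]
      exact h1 i
    · refine (norm_sub_le_norm_sub_add_norm_sub _ _ _).trans (add_le_add (h2 i) ?_)
      exact hor.grad_bias i _ hfeas

/-! ### One step of the method -/

lemma neg_log_one_sub_le {r : ℝ} (hr : r ≤ 3 / 5) : -Real.log (1 - r) ≤ r + 5 / 2 * r ^ 2 := by
  have h1 : 0 < 1 - r := by linarith
  rw [← Real.log_inv]
  refine (Real.log_le_sub_one_of_pos (inv_pos.2 h1)).trans ?_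
  have : (1 - r)⁻¹ - 1 = r + r ^ 2 * (1 - r)⁻¹ := by field_simp; ring
  rw [this]
  have h2 : (1 - r)⁻¹ ≤ 5 / 2 := by
    rw [inv_le_comm₀ h1 (by norm_num)]; linarith
  nlinarith [mul_le_mul_of_nonneg_left h2 (sq_nonneg r)]

/-- The effect of a step of length `h` on one barrier term, where `α` is the slack of the
constraint, `θ` its slope along the step and `αl`, `θh` are estimates of both. The term
`√(αl * M)` in the step length absorbs the error of `θh`. -/
lemma barrier_term_step {α αl θ θh M h : ℝ} (hαl : 0 < αl) (hM : 0 < M) (hθh : 0 ≤ θh) (hh : 0 ≤ h)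
    (h2 : αl ≤ 21 / 20 * α) (hθ : |θ| ≤ θh + √(αl * M) / 20)
    (hlen : h * (2 * θh + √(αl * M)) ≤ αl) :
    h * θ + M / 2 * h ^ 2 ≤ 3 / 5 * α ∧
    -Real.log (1 - (h * θ + M / 2 * h ^ 2) / α) ≤
      h * θ / α + h ^ 2 / 2 * (10 * (M / αl) + 8 * (θh ^ 2 / αl ^ 2)) := by
  set y := √(αl * M) with hy
  have hy0 : 0 < y := Real.sqrt_pos.2 (by positivity)
  have hy2 : y ^ 2 = αl * M := Real.sq_sqrt (by positivity)
  have hα : 0 < α := by linarith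
  have hhy : h * y ≤ αl := by nlinarith
  have hMh : M * h ≤ y := by
    have : αl * (M * h) ≤ αl * y := by
      calc αl * (M * h) = (h * y) * y := by rw [← mul_assoc, ← hy2]; ring
        _ ≤ αl * y := by gcongr
    exact le_of_mul_le_mul_left this hαl
  have hMh2 : M * h ^ 2 ≤ h * y := by nlinarith
  set R := h * |θ| + M / 2 * h ^ 2 with hR
  have hR0 : 0 ≤ R := by positivity
  have hRle : R ≤ h * (θh + 11 / 20 * y) := by
    have := mul_le_mul_of_nonneg_left hθ hh
    rw [hR]; linarith
  have hRα : R ≤ 3 / 5 * α := by nlinarith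
  have habs : |h * θ + M / 2 * h ^ 2| ≤ R := by
    refine (abs_add_le _ _).trans ?_
    rw [abs_mul, abs_of_nonneg hh, abs_of_nonneg (by positivity : 0 ≤ M / 2 * h ^ 2)]
  have hle : h * θ + M / 2 * h ^ 2 ≤ R := (le_abs_self _).trans habs
  refine ⟨hle.trans hRα, ?_⟩
  have hr : (h * θ + M / 2 * h ^ 2) / α ≤ 3 / 5 := by
    rw [div_le_iff₀ hα]; exact hle.trans hRα
  refine (neg_log_one_sub_le hr).trans ?_
  have hR2 : R ^ 2 ≤ h ^ 2 * (5 / 4 * θh ^ 2 + 121 / 80 * (αl * M)) := by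
    calc R ^ 2 ≤ (h * (θh + 11 / 20 * y)) ^ 2 := by gcongr
      _ ≤ h ^ 2 * (5 / 4 * θh ^ 2 + 121 / 80 * (αl * M)) := by
        rw [mul_pow, ← hy2]
        refine mul_le_mul_of_nonneg_left ?_ (sq_nonneg h)
        nlinarith [sq_nonneg (θh / 2 - 11 / 10 * y)]
  have hsq : ((h * θ + M / 2 * h ^ 2) / α) ^ 2 ≤ R ^ 2 / α ^ 2 := by
    rw [div_pow, ← sq_abs (h * θ + _)]; gcongr
  have hinv : 1 / α ^ 2 ≤ 441 / 400 * (1 / αl ^ 2) := by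
    rw [div_le_iff₀ (by positivity), mul_one_div, div_mul_eq_mul_div, le_div_iff₀ (by positivity)]
    nlinarith
  have hinv1 : 1 / α ≤ 21 / 20 * (1 / αl) := by
    rw [div_le_iff₀ (by positivity), mul_one_div, div_mul_eq_mul_div, le_div_iff₀ (by positivity)]
    linarith
  have e1 : R ^ 2 / α ^ 2 ≤ h ^ 2 * (5 / 4 * θh ^ 2 + 121 / 80 * (αl * M)) *
      (441 / 400 * (1 / αl ^ 2)) := by
    rw [div_eq_mul_one_div]; gcongr
  have e2 : h ^ 2 * (5 / 4 * θh ^ 2 + 121 / 80 * (αl * M)) * (441 / 400 * (1 / αl ^ 2)) =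
      h ^ 2 * (441 / 320 * (θh ^ 2 / αl ^ 2) + 53361 / 32000 * (M / αl)) := by
    field_simp; ring
  have e3 : (h * θ + M / 2 * h ^ 2) / α = h * θ / α + M / 2 * h ^ 2 * (1 / α) := by
    field_simp
  have e4 : M / 2 * h ^ 2 * (1 / α) ≤ h ^ 2 * (21 / 40 * (M / αl)) := by
    calc M / 2 * h ^ 2 * (1 / α) ≤ M / 2 * h ^ 2 * (21 / 20 * (1 / αl)) := by gcongr
      _ = _ := by field_simp; ring
  have p1 : 0 ≤ h ^ 2 * (θh ^ 2 / αl ^ 2) := by positivity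
  have p2 : 0 ≤ h ^ 2 * (M / αl) := by positivity
  rw [e2] at e1
  linarith

/-- If finitely many continuous functions start below `v` and one of them ends at or above `v`,
then at some time all are at most `v`, with equality for one of them. -/
lemma exists_max_eq {ι : Type*} [Fintype ι] {φ : ι → ℝ → ℝ} (hφ : ∀ i, Continuous (φ i))
    {h v : ℝ} (hh : 0 ≤ h) (h0 : ∀ i, φ i 0 < v) (hex : ∃ i, v ≤ φ i h) :
    ∃ τ ∈ Set.Icc 0 h, (∀ i, φ i τ ≤ v) ∧ ∃ i, φ i τ = v := by
  obtain ⟨k, hk⟩ := hex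
  have hne : (Finset.univ : Finset ι).Nonempty := ⟨k, Finset.mem_univ k⟩
  have hc : Continuous fun τ => Finset.univ.sup' hne fun i => φ i τ :=
    Continuous.finset_sup'_apply hne fun i _ => hφ i
  have hmem : v ∈ Set.Icc (Finset.univ.sup' hne fun i => φ i 0)
      (Finset.univ.sup' hne fun i => φ i h) :=
    ⟨(Finset.sup'_lt_iff hne).2 (fun i _ => h0 i) |>.le,
      hk.trans (Finset.le_sup' (fun i => φ i h) (Finset.mem_univ k))⟩
  obtain ⟨τ, hτ, hτv⟩ := intermediate_value_Icc hh hc.continuousOn hmem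
  simp only at hτv
  obtain ⟨i, -, hi⟩ := Finset.exists_mem_eq_sup' hne fun i => φ i τ
  exact ⟨τ, hτ, fun j => hτv ▸ Finset.le_sup' (fun i => φ i τ) (Finset.mem_univ j),
    i, hi.symm.trans hτv⟩

/-- A step `x ↦ x - γ • g` whose length respects the estimates `αl` of the slacks `-f i.succ x` and
`θh` of the slopes along `g`. An estimate of a slack may exceed it by a factor `21 / 20`, and an
estimate of a slope may fall short by a fraction of the term `√(αl * M)` in the step length. -/
structure IsSafeStep {d m : ℕ} (f : Fin (m + 1) → Euc d → ℝ) (M : Fin (m + 1) → ℝ) (x g : Euc d)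
    (γ : ℝ) (αl θh : Fin m → ℝ) : Prop where
  mem : x ∈ strictlyFeasible f
  g_ne : g ≠ 0
  γ_nonneg : 0 ≤ γ
  αl_pos : ∀ i, 0 < αl i
  θh_nonneg : ∀ i, 0 ≤ θh i
  le_slack : ∀ i, αl i ≤ 21 / 20 * -f i.succ x
  slope_le : ∀ i, |inner ℝ (gradient (f i.succ) x) (‖g‖⁻¹ • g)| ≤
    θh i + √(αl i * M i.succ) / 20
  length_le : ∀ i, γ * ‖g‖ * (2 * θh i + √(αl i * M i.succ)) ≤ αl i

lemma strictlyFeasible_subset {d m : ℕ} (f : Fin (m + 1) → Euc d → ℝ) :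
    strictlyFeasible f ⊆ feasibleSet f := fun _ hx i => (hx i).le

/-- The partial sum over `S` of the terms of the gradient of `x ↦ ∑ i, -log (-f i.succ x)`. -/
noncomputable def slackGradient {d m : ℕ} (f : Fin (m + 1) → Euc d → ℝ) (S : Finset (Fin m))
    (x : Euc d) : Euc d :=
  ∑ i ∈ S, (-f i.succ x)⁻¹ • gradient (f i.succ) x

namespace IsSafeStep

variable {d m : ℕ} {f : Fin (m + 1) → Euc d → ℝ} {M : Fin (m + 1) → ℝ} {x g : Euc d} {γ : ℝ}
  {αl θh : Fin m → ℝ}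

/-- A safe step keeps `2 / 5` of every slack. The path to the new point stays feasible, since at the
first contact with the boundary the smoothness bound would give a positive slack. -/
lemma slack_next (hs : IsSafeStep f M x g γ αl θh) (hf : ∀ i, Continuous (f i))
    (hM : ∀ i, 0 < M i) (hsm : ∀ i, SmoothOnSet (f i) (M i) (feasibleSet f)) :
    x - γ • g ∈ strictlyFeasible f ∧ ∀ i : Fin m, 2 / 5 * -f i.succ x ≤ -f i.succ (x - γ • g) := by
  have hgn : 0 < ‖g‖ := norm_pos_iff.2 hs.g_ne
  set u : Euc d := -(‖g‖⁻¹ • g) with hu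
  have hun : ‖u‖ = 1 := by
    rw [hu, norm_neg, norm_smul, norm_inv, norm_norm, inv_mul_cancel₀ hgn.ne']
  have hx1 : x + (γ * ‖g‖) • u = x - γ • g := by
    rw [hu, smul_neg, smul_smul, mul_assoc, mul_inv_cancel₀ hgn.ne', mul_one, sub_eq_add_neg]
  have hh : 0 ≤ γ * ‖g‖ := mul_nonneg hs.γ_nonneg hgn.le
  have hxf := strictlyFeasible_subset f hs.mem
  have key : ∀ τ ∈ Set.Icc 0 (γ * ‖g‖), x + τ • u ∈ feasibleSet f → ∀ i : Fin m,
      2 / 5 * -f i.succ x ≤ -f i.succ (x + τ • u) := by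
    intro τ hτ hmem i
    have h1 := (hsm i.succ).2 _ hmem x hxf
    rw [add_sub_cancel_left, inner_smul_right, norm_smul, hun, Real.norm_of_nonneg hτ.1,
      mul_one] at h1
    have hlen : τ * (2 * θh i + √(αl i * M i.succ)) ≤ αl i := by
      refine le_trans (mul_le_mul_of_nonneg_right hτ.2 ?_) (hs.length_le i)
      have := hs.θh_nonneg i
      positivity
    have hsl : |inner ℝ (gradient (f i.succ) x) u| ≤ θh i + √(αl i * M i.succ) / 20 := by
      rw [hu, inner_neg_right, abs_neg]; exact hs.slope_le i
    have h2 := (barrier_term_step (hs.αl_pos i) (hM i.succ) (hs.θh_nonneg i) hτ.1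
      (hs.le_slack i) hsl hlen).1
    linarith
  have hstrict : x + (γ * ‖g‖) • u ∈ strictlyFeasible f := by
    by_contra hcon
    have hex : ∃ i : Fin m, 0 ≤ f i.succ (x + (γ * ‖g‖) • u) := by
      simpa [strictlyFeasible] using hcon
    obtain ⟨τ, hτ, hle, i, hi⟩ := exists_max_eq (φ := fun (i : Fin m) τ => f i.succ (x + τ • u))
      (fun i => (hf i.succ).comp (by fun_prop)) hh (fun i => by simpa using hs.mem i) hex
    have := key τ hτ hle i
    have := hs.mem i
    linarith
  rw [← hx1]
  exact ⟨hstrict, key _ ⟨hh, le_rfl⟩ (strictlyFeasible_subset f hstrict)⟩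

/-- Local quadratic upper bound for one term of the barrier. -/
lemma neg_log_next (hs : IsSafeStep f M x g γ αl θh) (hf : ∀ i, Continuous (f i))
    (hM : ∀ i, 0 < M i) (hsm : ∀ i, SmoothOnSet (f i) (M i) (feasibleSet f)) (i : Fin m) :
    -Real.log (-f i.succ (x - γ • g)) ≤ -Real.log (-f i.succ x)
      - γ * inner ℝ ((-f i.succ x)⁻¹ • gradient (f i.succ) x) g
      + γ ^ 2 * ‖g‖ ^ 2 / 2 * (10 * (M i.succ / αl i) + 8 * (θh i ^ 2 / αl i ^ 2)) := by
  have hgn : 0 < ‖g‖ := norm_pos_iff.2 hs.g_ne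
  have hnext := (hs.slack_next hf hM hsm).1
  have hα : 0 < -f i.succ x := neg_pos.2 (hs.mem i)
  have hsl : |(-inner ℝ (gradient (f i.succ) x) (‖g‖⁻¹ • g))| ≤ θh i + √(αl i * M i.succ) / 20 := by
    rw [abs_neg]; exact hs.slope_le i
  obtain ⟨h1, h2⟩ := barrier_term_step (hs.αl_pos i) (hM i.succ) (hs.θh_nonneg i)
    (mul_nonneg hs.γ_nonneg hgn.le) (hs.le_slack i) hsl (hs.length_le i)
  have e1 : γ * ‖g‖ * -inner ℝ (gradient (f i.succ) x) (‖g‖⁻¹ • g) =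
      -(γ * inner ℝ (gradient (f i.succ) x) g) := by
    rw [inner_smul_right]; field_simp
  rw [e1] at h1 h2
  set P := -(γ * inner ℝ (gradient (f i.succ) x) g) + M i.succ / 2 * (γ * ‖g‖) ^ 2 with hP
  have h3 := (hsm i.succ).2 _ (strictlyFeasible_subset f hnext) x (strictlyFeasible_subset f hs.mem)
  rw [sub_sub_cancel_left, inner_neg_right, inner_smul_right, norm_neg, norm_smul,
    Real.norm_of_nonneg hs.γ_nonneg] at h3
  have h4 : -f i.succ x * (1 - P / -f i.succ x) ≤ -f i.succ (x - γ • g) := by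
    rw [mul_sub, mul_one, mul_div_cancel₀ _ hα.ne']; linarith
  have h5 : 0 < 1 - P / -f i.succ x := by
    have : P / -f i.succ x ≤ 3 / 5 := by rw [div_le_iff₀ hα]; exact h1
    linarith
  have h6 := Real.log_le_log (mul_pos hα h5) h4
  rw [Real.log_mul hα.ne' h5.ne'] at h6
  have e2 : γ * inner ℝ ((-f i.succ x)⁻¹ • gradient (f i.succ) x) g =
      γ * inner ℝ (gradient (f i.succ) x) g / -f i.succ x := by
    rw [inner_smul_left]
    simp only [conj_trivial]
    rw [div_eq_mul_inv]; ring
  rw [e2]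
  rw [neg_div, mul_pow] at h2
  linarith

variable {η : ℝ}

lemma sum_neg_log_next (hs : IsSafeStep f M x g γ αl θh) (hf : ∀ i, Continuous (f i))
    (hM : ∀ i, 0 < M i) (hsm : ∀ i, SmoothOnSet (f i) (M i) (feasibleSet f)) (hη : 0 ≤ η)
    (S : Finset (Fin m)) :
    η * ∑ i ∈ S, -Real.log (-f i.succ (x - γ • g)) ≤ η * ∑ i ∈ S, -Real.log (-f i.succ x)
      - γ * inner ℝ (η • slackGradient f S x) g
      + γ ^ 2 * ‖g‖ ^ 2 / 2 *
        (10 * η * ∑ i, M i.succ / αl i + 8 * η * ∑ i, θh i ^ 2 / αl i ^ 2) := by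
  have h1 := mul_le_mul_of_nonneg_left
    (Finset.sum_le_sum fun i (_ : i ∈ S) => hs.neg_log_next hf hM hsm i) hη
  refine h1.trans ?_
  rw [Finset.sum_add_distrib, Finset.sum_sub_distrib, ← Finset.mul_sum, ← Finset.mul_sum,
    ← sum_inner, inner_smul_left]
  simp only [conj_trivial]
  have h2 : ∑ i ∈ S, (10 * (M i.succ / αl i) + 8 * (θh i ^ 2 / αl i ^ 2)) ≤
      ∑ i, (10 * (M i.succ / αl i) + 8 * (θh i ^ 2 / αl i ^ 2)) := by
    refine Finset.sum_le_sum_of_subset_of_nonneg (Finset.subset_univ S) fun i _ _ => ?_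
    have h3 := hM i.succ
    have h4 := hs.αl_pos i
    positivity
  rw [Finset.sum_add_distrib (s := Finset.univ), ← Finset.mul_sum, ← Finset.mul_sum] at h2
  have h5 := mul_le_mul_of_nonneg_left h2
    (by positivity : 0 ≤ η * (γ ^ 2 * ‖g‖ ^ 2 / 2))
  rw [slackGradient]
  linarith

/-- Along a safe step with `γ ≤ 1 / M₂` the product of the slacks in `S` does not decrease, when
the part of `g` that comes from `S` dominates the rest. -/
lemma sum_log_next (hs : IsSafeStep f M x g γ αl θh) (hf : ∀ i, Continuous (f i))
    (hM : ∀ i, 0 < M i) (hsm : ∀ i, SmoothOnSet (f i) (M i) (feasibleSet f)) (hη : 0 < η)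
    (hγ : γ * (M 0 + 10 * η * ∑ i, M i.succ / αl i + 8 * η * ∑ i, θh i ^ 2 / αl i ^ 2) ≤ 1)
    {S : Finset (Fin m)} (hS : ‖g - η • slackGradient f S x‖ ≤ ‖η • slackGradient f S x‖) :
    ∑ i ∈ S, Real.log (-f i.succ x) ≤ ∑ i ∈ S, Real.log (-f i.succ (x - γ • g)) := by
  have h1 := hs.sum_neg_log_next hf hM hsm hη.le S
  set v := η • slackGradient f S x with hv
  set Q := 10 * η * ∑ i, M i.succ / αl i + 8 * η * ∑ i, θh i ^ 2 / αl i ^ 2 with hQ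
  have hγQ : γ * Q ≤ 1 := by
    have := mul_nonneg hs.γ_nonneg (hM 0).le
    rw [hQ]; linarith
  have h2 : ‖g - v‖ ^ 2 ≤ ‖v‖ ^ 2 := by gcongr
  rw [norm_sub_sq_real] at h2
  rw [real_inner_comm] at h2
  have h3 : γ ^ 2 * ‖g‖ ^ 2 / 2 * Q ≤ γ * ‖g‖ ^ 2 / 2 := by
    calc γ ^ 2 * ‖g‖ ^ 2 / 2 * Q = γ * ‖g‖ ^ 2 / 2 * (γ * Q) := by ring
      _ ≤ γ * ‖g‖ ^ 2 / 2 * 1 := by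
        have := hs.γ_nonneg
        gcongr
      _ = _ := mul_one _
  have h4 : γ * (‖g‖ ^ 2 / 2 - inner ℝ v g) ≤ 0 :=
    mul_nonpos_of_nonneg_of_nonpos hs.γ_nonneg (by linarith)
  rw [Finset.sum_neg_distrib, Finset.sum_neg_distrib] at h1
  nlinarith

/-- Descent of the log barrier along a safe step with `γ ≤ 1 / M₂`. -/
lemma logBarrier_next (hs : IsSafeStep f M x g γ αl θh) (hf : ∀ i, Continuous (f i))
    (hM : ∀ i, 0 < M i) (hsm : ∀ i, SmoothOnSet (f i) (M i) (feasibleSet f)) (hη : 0 < η)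
    (hγ : γ * (M 0 + 10 * η * ∑ i, M i.succ / αl i + 8 * η * ∑ i, θh i ^ 2 / αl i ^ 2) ≤ 1) :
    logBarrier f η (x - γ • g) ≤ logBarrier f η x
      - γ * (inner ℝ (gradient (f 0) x + η • slackGradient f Finset.univ x) g - ‖g‖ ^ 2 / 2) := by
  have h1 := hs.sum_neg_log_next hf hM hsm hη.le Finset.univ
  have h2 := (hsm 0).2 _ (strictlyFeasible_subset f (hs.slack_next hf hM hsm).1) x
    (strictlyFeasible_subset f hs.mem)
  rw [sub_sub_cancel_left, inner_neg_right, inner_smul_right, norm_neg, norm_smul,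
    Real.norm_of_nonneg hs.γ_nonneg] at h2
  rw [inner_add_left]
  have h3 := mul_le_mul_of_nonneg_left hγ
    (by have := hs.γ_nonneg; positivity : 0 ≤ γ * ‖g‖ ^ 2 / 2)
  simp only [logBarrier]
  nlinarith

end IsSafeStep

/-! ### Distance to the boundary -/

/-- Lower bounds `E ^ (-k (2 m + 1 - k))` on the products of any `k` rescaled slacks
`-f i.succ x / η`. Since `k (2 m + 1 - k)` is strictly concave in `k`, the factors of a product near
its bound are small compared with the slacks outside it. -/
def SlackProducts {d m : ℕ} (f : Fin (m + 1) → Euc d → ℝ) (η E : ℝ) (x : Euc d) : Prop :=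
  ∀ S : Finset (Fin m), (E ^ (S.card * (2 * m + 1 - S.card)))⁻¹ ≤ ∏ i ∈ S, (-f i.succ x / η)

lemma SlackProducts.le_slack {d m : ℕ} {f : Fin (m + 1) → Euc d → ℝ} {η E : ℝ} {x : Euc d}
    (h : SlackProducts f η E x) (hη : 0 < η) (i : Fin m) : (E ^ (2 * m))⁻¹ * η ≤ -f i.succ x := by
  have := h {i}
  simp only [Finset.card_singleton, one_mul, Finset.prod_singleton, add_tsub_cancel_right] at this
  rwa [le_div_iff₀ hη] at this

lemma slackProducts_of_le {d m : ℕ} {f : Fin (m + 1) → Euc d → ℝ} {η E : ℝ} {x : Euc d}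
    (hη : 0 < η) (hE : 1 ≤ E) (h : ∀ i : Fin m, η ≤ -f i.succ x) : SlackProducts f η E x := by
  intro S
  refine (inv_le_one_of_one_le₀ (one_le_pow₀ hE)).trans ?_
  simpa using Finset.prod_le_prod (s := S) (f := fun _ => (1 : ℝ)) (fun _ _ => zero_le_one)
    fun i _ => (one_le_div hη).2 (h i)

/-- The neighbourhood hypothesis matters: at a boundary point of `X` the gradient is not controlled
by the values on `X`. -/
lemma norm_gradient_le_of_lipschitzOnSet {d : ℕ} {h : Euc d → ℝ} {L : ℝ} (hL : 0 ≤ L)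
    {X : Set (Euc d)} (hh : LipschitzOnSet h L X) {x : Euc d} (hx : X ∈ nhds x) :
    ‖gradient h x‖ ≤ L := by
  rw [gradient, LinearIsometryEquiv.norm_map]
  refine norm_fderiv_le_of_lip' ℝ hL ?_
  filter_upwards [hx] with y hy
  exact hh y hy x (mem_of_mem_nhds hx)

lemma isOpen_strictlyFeasible {d m : ℕ} {f : Fin (m + 1) → Euc d → ℝ} (hf : ∀ i, Continuous (f i)) :
    IsOpen (strictlyFeasible f) := by
  have : strictlyFeasible f = ⋂ i : Fin m, {x | f i.succ x < 0} := by
    ext x; simp [strictlyFeasible]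
  rw [this]
  exact isOpen_iInter_of_finite fun i => isOpen_lt (hf _) continuous_const

lemma feasibleSet_mem_nhds {d m : ℕ} {f : Fin (m + 1) → Euc d → ℝ} (hf : ∀ i, Continuous (f i))
    {x : Euc d} (hx : x ∈ strictlyFeasible f) : feasibleSet f ∈ nhds x :=
  Filter.mem_of_superset ((isOpen_strictlyFeasible hf).mem_nhds hx) (strictlyFeasible_subset f)

/-- The numerical inequality behind the invariance of `SlackProducts`: with `k` constraints in the
group and `q` outside, the pull of the group dominates that of the rest. -/
lemma group_dominates {E l Lm : ℝ} {k q : ℕ} (hk : 1 ≤ k) (hl : 0 < l) (hL : l ≤ Lm)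
    (hE0 : 0 < E) (hE : E ^ 2 = 4 * Lm * (2 * (k + q : ℕ) + 1) / l) :
    Lm * (21 / 20 + q * ((5 / 2) ^ k * E ^ (2 * q))) ≤ l * (2 / 5 * E ^ (k + 2 * q + 1)) := by
  obtain ⟨j, rfl⟩ : ∃ j, k = j + 1 := ⟨k - 1, by omega⟩
  have hL0 : 0 < Lm := hl.trans_le hL
  have hlE : l * E ^ 2 = 4 * Lm * (2 * (j + 1 + q : ℕ) + 1) := by rw [hE]; field_simp
  have hj0 : (0 : ℝ) ≤ j := Nat.cast_nonneg j
  have hq0 : (0 : ℝ) ≤ q := Nat.cast_nonneg q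
  have hE2 : (5 / 2 : ℝ) ≤ E := by
    push_cast at hlE
    have h12 : (12 : ℝ) ≤ E ^ 2 := by
      have : l * 12 ≤ l * E ^ 2 := by
        rw [hlE]
        nlinarith [mul_nonneg hL0.le hj0, mul_nonneg hL0.le hq0]
      exact le_of_mul_le_mul_left this hl
    nlinarith
  have h1E : (1 : ℝ) ≤ E := by linarith
  set X : ℝ := (5 / 2) ^ (j + 1) * E ^ (2 * q) with hX
  have hX1 : 1 ≤ X := one_le_mul_of_one_le_of_one_le (one_le_pow₀ (by norm_num)) (one_le_pow₀ h1E)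
  have hlow : 2 / 5 * X * E ^ 2 ≤ E ^ (j + 1 + 2 * q + 1) := by
    have h1 : (5 / 2 : ℝ) ^ j ≤ E ^ j := by gcongr
    calc 2 / 5 * X * E ^ 2 = (5 / 2) ^ j * (E ^ (2 * q) * E ^ 2) := by rw [hX, pow_succ]; ring
      _ ≤ E ^ j * (E ^ (2 * q) * E ^ 2) := by gcongr
      _ = _ := by ring
  have h2 : l * (2 / 5 * (2 / 5 * X * E ^ 2)) ≤ l * (2 / 5 * E ^ (j + 1 + 2 * q + 1)) := by gcongr
  have h3 : l * (2 / 5 * (2 / 5 * X * E ^ 2)) = 16 / 25 * (2 * (j + 1 + q : ℕ) + 1) * (Lm * X) := by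
    calc _ = 4 / 25 * X * (l * E ^ 2) := by ring
      _ = _ := by rw [hlE]; ring
  refine le_trans ?_ h2
  rw [h3]
  push_cast
  have hLX : Lm ≤ Lm * X := le_mul_of_one_le_right hL0.le hX1
  have hLX0 : 0 ≤ Lm * X := hL0.le.trans hLX
  nlinarith [mul_nonneg hLX0 hj0, mul_nonneg hLX0 hq0]

/-- Safe steps preserve the bounds on the products of slacks. Suppose a smallest group `S` violated
its bound after the step. Before the step all its slacks are then at most `η ≤ ρ`, so that MFCQ
bounds the pull of the group from below, and this pull dominates the pull of the other terms. But
then the product over `S` does not decrease. -/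
lemma SlackProducts.next {d m : ℕ} {f : Fin (m + 1) → Euc d → ℝ} {M : Fin (m + 1) → ℝ}
    {x g : Euc d} {γ : ℝ} {αl θh : Fin m → ℝ} {η ρ l Lm E : ℝ}
    (hs : IsSafeStep f M x g γ αl θh) (hf : ∀ i, Continuous (f i))
    (hM : ∀ i, 0 < M i) (hsm : ∀ i, SmoothOnSet (f i) (M i) (feasibleSet f)) (hη : 0 < η)
    (hηρ : η ≤ ρ)
    (hγ : γ * (M 0 + 10 * η * ∑ i, M i.succ / αl i + 8 * η * ∑ i, θh i ^ 2 / αl i ^ 2) ≤ 1)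
    (hmfcq : ExtendedMFCQ f ρ l) (hgrad : ∀ i, ‖gradient (f i) x‖ ≤ Lm) (hl : 0 < l) (hL : l ≤ Lm)
    (hE0 : 0 < E) (hE : E ^ 2 = 4 * Lm * (2 * m + 1) / l)
    (hg : ‖g - (gradient (f 0) x + η • slackGradient f Finset.univ x)‖ ≤ Lm / 20)
    (h : SlackProducts f η E x) : SlackProducts f η E (x - γ • g) := by
  obtain ⟨hstrict, hslack⟩ := hs.slack_next hf hM hsm
  have hL0 : 0 < Lm := hl.trans_le hL
  set u : Fin m → ℝ := fun i => -f i.succ x / η with hu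
  set w : Fin m → ℝ := fun i => -f i.succ (x - γ • g) / η with hw
  have hu0 : ∀ i, 0 < u i := fun i => div_pos (neg_pos.2 (hs.mem i)) hη
  have hw0 : ∀ i, 0 < w i := fun i => div_pos (neg_pos.2 (hstrict i)) hη
  have huw : ∀ i, u i ≤ 5 / 2 * w i := fun i => by
    rw [hu, hw, ← mul_div_assoc]
    exact div_le_div_of_nonneg_right (by linarith [hslack i]) hη.le
  intro S
  induction S using Finset.strongInduction with
  | H S ih =>
  by_contra! hcon
  change ∏ i ∈ S, w i < _ at hcon
  rcases S.eq_empty_or_nonempty with rfl | hne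
  · simp at hcon
  obtain ⟨q, hq⟩ : ∃ q, m = S.card + q :=
    ⟨m - S.card, by have := S.card_le_univ; rw [Fintype.card_fin] at this; omega⟩
  set k := S.card with hk
  have hk1 : 1 ≤ k := hne.card_pos
  have ek : 2 * m + 1 - k = k + 2 * q + 1 := by omega
  rw [ek] at hcon
  have hE' : E ^ 2 = 4 * Lm * (2 * (k + q : ℕ) + 1) / l := by rw [hE, hq]
  have hm1 : (1 : ℝ) ≤ (k + q : ℕ) := by exact_mod_cast (by omega : 1 ≤ k + q)
  have h12 : (12 : ℝ) ≤ E ^ 2 := by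
    rw [hE', le_div_iff₀ hl]; nlinarith
  have hE1 : 1 ≤ E := by nlinarith
  -- every slack of the group is at most `η`
  have hsmall : ∀ j ∈ S, u j ≤ 1 := by
    intro j hj
    obtain ⟨k', hk'⟩ : ∃ k', k = k' + 1 := ⟨k - 1, by omega⟩
    have h1 := ih (S.erase j) (Finset.erase_ssubset hj)
    change _ ≤ ∏ i ∈ S.erase j, w i at h1
    have hcard : (S.erase j).card = k' := by rw [Finset.card_erase_of_mem hj]; omega
    have ek' : 2 * m + 1 - k' = k' + 2 * q + 3 := by omega
    rw [hcard, ek'] at h1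
    rw [← Finset.mul_prod_erase S w hj, hk'] at hcon
    have h2 := (mul_le_mul_of_nonneg_left h1 (hw0 j).le).trans_lt hcon
    have e : E ^ ((k' + 1) * (k' + 1 + 2 * q + 1)) =
        E ^ (k' * (k' + 2 * q + 3)) * E ^ (2 * q + 2) := by
      rw [← pow_add]; ring_nf
    rw [e, mul_inv, mul_comm _ (E ^ (2 * q + 2))⁻¹] at h2
    have h3 : w j < (E ^ (2 * q + 2))⁻¹ := lt_of_mul_lt_mul_right h2 (by positivity)
    have h4 : (E ^ (2 * q + 2))⁻¹ ≤ (E ^ 2)⁻¹ := by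
      apply inv_anti₀ (by positivity)
      exact pow_le_pow_right₀ hE1 (by omega)
    have h5 : (E ^ 2)⁻¹ ≤ 12⁻¹ := inv_anti₀ (by norm_num) h12
    have h6 := huw j
    linarith
  -- the group pulls strongly
  have hpull : 2 / 5 * E ^ (k + 2 * q + 1) ≤ ∑ i ∈ S, (u i)⁻¹ := by
    obtain ⟨j, hj, hjw⟩ : ∃ j ∈ S, w j ≤ (E ^ (k + 2 * q + 1))⁻¹ := by
      by_contra! hall
      have h1 : ∏ _i ∈ S, (E ^ (k + 2 * q + 1))⁻¹ ≤ ∏ i ∈ S, w i :=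
        Finset.prod_le_prod (fun _ _ => by positivity) fun i hi => (hall i hi).le
      rw [Finset.prod_const, ← hk, inv_pow, ← pow_mul, mul_comm] at h1
      exact absurd hcon (not_lt.2 h1)
    have h1 : u j ≤ 5 / 2 * (E ^ (k + 2 * q + 1))⁻¹ := (huw j).trans (by gcongr)
    have h2 : (5 / 2 * (E ^ (k + 2 * q + 1))⁻¹)⁻¹ ≤ (u j)⁻¹ := inv_anti₀ (hu0 j) h1
    rw [mul_inv, inv_inv] at h2
    refine le_trans (by norm_num at h2 ⊢; exact h2) (Finset.single_le_sum (f := fun i => (u i)⁻¹)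
      (fun i _ => (inv_pos.2 (hu0 i)).le) hj)
  -- the other constraints pull weakly
  have hrest : ∀ i ∈ Sᶜ, (u i)⁻¹ ≤ (5 / 2) ^ k * E ^ (2 * q) := by
    intro i hi
    have hi' : i ∉ S := Finset.mem_compl.1 hi
    have h1 := h (insert i S)
    have hlt : S.card < m := by
      have := (Finset.card_le_univ (insert i S))
      rw [Finset.card_insert_of_notMem hi', Fintype.card_fin] at this
      omega
    obtain ⟨q', hq'⟩ : ∃ q', q = q' + 1 := ⟨q - 1, by omega⟩
    have e1 : 2 * m + 1 - (k + 1) = k + 2 * q := by omega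
    rw [Finset.card_insert_of_notMem hi', Finset.prod_insert hi', ← hk, e1] at h1
    change _ ≤ u i * ∏ i ∈ S, u i at h1
    have h2 : ∏ i ∈ S, u i ≤ (5 / 2) ^ k * ∏ i ∈ S, w i := by
      rw [hk, ← Finset.prod_const, ← Finset.prod_mul_distrib]
      exact Finset.prod_le_prod (fun i _ => (hu0 i).le) fun i _ => huw i
    have h3 : (E ^ ((k + 1) * (k + 2 * q)))⁻¹ ≤
        u i * ((5 / 2) ^ k * (E ^ (k * (k + 2 * q + 1)))⁻¹) := by
      refine h1.trans (mul_le_mul_of_nonneg_left (h2.trans ?_) (hu0 i).le)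
      gcongr
    have e2 : E ^ ((k + 1) * (k + 2 * q)) = E ^ (k * (k + 2 * q + 1)) * E ^ (2 * q) := by
      rw [← pow_add]; ring_nf
    rw [e2, mul_inv, ← mul_assoc, mul_comm _ (E ^ (2 * q))⁻¹] at h3
    have h4 : (E ^ (2 * q))⁻¹ ≤ u i * (5 / 2) ^ k := le_of_mul_le_mul_right h3 (by positivity)
    rw [inv_le_iff_one_le_mul₀ (hu0 i)]
    rw [inv_le_iff_one_le_mul₀ (by positivity)] at h4
    linarith
  have hdom := group_dominates hk1 hl hL hE0 hE'
  have hsg : ∀ S', η • slackGradient f S' x = ∑ i ∈ S', (u i)⁻¹ • gradient (f i.succ) x := by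
    intro S'
    rw [slackGradient, Finset.smul_sum]
    refine Finset.sum_congr rfl fun i _ => ?_
    rw [smul_smul, hu]
    simp only [inv_div, div_eq_mul_inv η]
  have hv := hsg S
  have hvc : η • slackGradient f Finset.univ x - η • slackGradient f S x =
      ∑ i ∈ Sᶜ, (u i)⁻¹ • gradient (f i.succ) x := by
    rw [hsg, hsg, sub_eq_iff_eq_add', Finset.sum_add_sum_compl]
  have hvlow : l * ∑ i ∈ S, (u i)⁻¹ ≤ ‖η • slackGradient f S x‖ := by
    obtain ⟨s, hs1, hs2⟩ := hmfcq x (strictlyFeasible_subset f hs.mem)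
    have h1 := real_inner_le_norm s (η • slackGradient f S x)
    rw [hs1, one_mul] at h1
    refine le_trans ?_ h1
    rw [hv, inner_sum, Finset.mul_sum]
    refine Finset.sum_le_sum fun i hi => ?_
    rw [inner_smul_right, mul_comm]
    refine mul_le_mul_of_nonneg_left (hs2 i ?_).le (inv_pos.2 (hu0 i)).le
    have := hsmall i hi
    rw [hu] at this
    simp only [div_le_one hη] at this
    linarith
  have hwup : ‖g - η • slackGradient f S x‖ ≤
      Lm * (21 / 20 + q * ((5 / 2) ^ k * E ^ (2 * q))) := by
    have e : g - η • slackGradient f S x =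
        (g - (gradient (f 0) x + η • slackGradient f Finset.univ x)) + (gradient (f 0) x
          + ∑ i ∈ Sᶜ, (u i)⁻¹ • gradient (f i.succ) x) := by
      rw [← hvc]; abel
    have hsum : ‖∑ i ∈ Sᶜ, (u i)⁻¹ • gradient (f i.succ) x‖ ≤
        q * ((5 / 2) ^ k * E ^ (2 * q)) * Lm := by
      refine (norm_sum_le_of_le _ (n := fun _ => (5 / 2) ^ k * E ^ (2 * q) * Lm)
        fun i hi => ?_).trans (le_of_eq ?_)
      · rw [norm_smul, norm_inv, Real.norm_of_nonneg (hu0 i).le]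
        exact mul_le_mul (hrest i hi) (hgrad _) (norm_nonneg _) (by positivity)
      · rw [Finset.sum_const, Finset.card_compl, Fintype.card_fin, nsmul_eq_mul,
          show m - S.card = q by omega]
        ring
    rw [e]
    refine (norm_add_le _ _).trans ((add_le_add hg ((norm_add_le _ _).trans
      (add_le_add (hgrad 0) hsum))).trans ?_)
    linarith
  have hlog := hs.sum_log_next hf hM hsm hη hγ (hwup.trans (hdom.trans
    ((mul_le_mul_of_nonneg_left hpull hl.le).trans hvlow)))
  have hfin : ∏ i ∈ S, u i ≤ ∏ i ∈ S, w i := by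
    have hpos : ∀ y, y ∈ strictlyFeasible f → ∀ i : Fin m, 0 < -f i.succ y :=
      fun y hy i => neg_pos.2 (hy i)
    rw [← Real.log_prod fun i _ => (hpos _ hs.mem i).ne',
      ← Real.log_prod fun i _ => (hpos _ hstrict i).ne'] at hlog
    have := (Real.log_le_log_iff (Finset.prod_pos fun i _ => hpos _ hs.mem i)
      (Finset.prod_pos fun i _ => hpos _ hstrict i)).1 hlog
    rw [hu, hw, Finset.prod_div_distrib, Finset.prod_div_distrib]
    gcongr
  have hS := h S
  rw [← hk, ek] at hS
  exact absurd (hS.trans hfin) (not_le.2 hcon)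

/-! ### The log barrier -/

section Barrier

variable {d m : ℕ} {f : Fin (m + 1) → Euc d → ℝ}

lemma gradient_logBarrier {x : Euc d} (hx : x ∈ strictlyFeasible f)
    (hd : ∀ i, DifferentiableAt ℝ (f i) x) (η : ℝ) :
    gradient (logBarrier f η) x = gradient (f 0) x + η • slackGradient f Finset.univ x := by
  refine HasGradientAt.gradient ?_
  have h := fun i => (hd i).hasGradientAt.hasFDerivAt
  rw [hasGradientAt_iff_hasFDerivAt]
  have h1 := (h 0).add ((HasFDerivAt.fun_sum (u := Finset.univ) fun (i : Fin m) _ =>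
    ((h i.succ).neg.log (neg_ne_zero.2 (hx i).ne)).neg).const_mul η)
  refine h1.congr_fderiv ?_
  rw [map_add, map_smul, slackGradient, map_sum]
  simp only [map_smul, smul_neg, neg_neg, Pi.neg_apply]

lemma gradient_lagrangian {x : Euc d} (hd : ∀ i, DifferentiableAt ℝ (f i) x) (lam : Fin m → ℝ) :
    gradient (lagrangian f lam) x = gradient (f 0) x + ∑ i, lam i • gradient (f i.succ) x := by
  refine HasGradientAt.gradient ?_
  have h := fun i => (hd i).hasGradientAt.hasFDerivAt
  rw [hasGradientAt_iff_hasFDerivAt]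
  have h1 := (h 0).add (HasFDerivAt.fun_sum (u := Finset.univ) fun (i : Fin m) _ =>
    (h i.succ).const_mul (lam i))
  refine h1.congr_fderiv ?_
  rw [map_add, map_sum]
  simp only [map_smul]

/-- A nearly stationary point of the log barrier is an approximate KKT point, with multipliers
`η / (-f i.succ x)`. -/
lemma isApproxKKT_of_gradient_logBarrier {x : Euc d} (hx : x ∈ strictlyFeasible f)
    (hd : ∀ i, DifferentiableAt ℝ (f i) x) {η : ℝ} (hη : 0 ≤ η)
    (h : ‖gradient (logBarrier f η) x‖ ≤ η) : IsApproxKKT f η x := by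
  have hα : ∀ i : Fin m, 0 < -f i.succ x := fun i => neg_pos.2 (hx i)
  refine ⟨fun i => η * (-f i.succ x)⁻¹, fun i => ⟨mul_nonneg hη (inv_pos.2 (hα i)).le, (hα i).le⟩,
    fun i => (inv_mul_cancel_right₀ (hα i).ne' η).le, ?_⟩
  rw [gradient_logBarrier hx hd, slackGradient, Finset.smul_sum] at h
  rw [gradient_lagrangian hd]
  simpa only [smul_smul] using h

variable {x₀ : Euc d} {L M : Fin (m + 1) → ℝ} {R β ρ l : ℝ}

lemma ProblemAssumptions.start_mem (hp : ProblemAssumptions f x₀ L M R β ρ l) (hρ : 0 < ρ) :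
    x₀ ∈ strictlyFeasible f := fun i => by
  have := hp.start i
  have := hp.rho_le
  linarith

lemma ProblemAssumptions.isCompact_feasibleSet (hp : ProblemAssumptions f x₀ L M R β ρ l) :
    IsCompact (feasibleSet f) := by
  refine Metric.isCompact_of_isClosed_isBounded (isClosed_feasibleSet hp.continuous) ?_
  refine Metric.isBounded_iff.2 ⟨R, fun x hx y hy => ?_⟩
  rw [dist_eq_norm]
  exact hp.diameter x hx y hy

/-- The log barrier attains its minimum: its sublevel sets stay away from the boundary. -/
lemma ProblemAssumptions.exists_isMinOn (hp : ProblemAssumptions f x₀ L M R β ρ l) (hρ : 0 < ρ)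
    {η : ℝ} (hη : 0 < η) :
    ∃ x ∈ strictlyFeasible f, IsMinOn (logBarrier f η) (strictlyFeasible f) x := by
  have hx₀ := hp.start_mem hρ
  have hc := hp.isCompact_feasibleSet
  have hb : ∀ i, ∃ b, ∀ x ∈ feasibleSet f, |f i x| ≤ b := fun i =>
    hc.exists_bound_of_continuousOn (hp.continuous i).continuousOn
  choose b hb using hb
  set W : ℝ := 1 + ∑ i, |b i| with hW
  have hW1 : 1 ≤ W := le_add_of_nonneg_right (Finset.sum_nonneg fun i _ => abs_nonneg _)
  have hbW : ∀ i, ∀ x ∈ feasibleSet f, |f i x| ≤ W := fun i x hx => by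
    have := Finset.single_le_sum (f := fun i => |b i|) (fun i _ => abs_nonneg _) (Finset.mem_univ i)
    have := hb i x hx
    have := le_abs_self (b i)
    linarith
  have hlogW : 0 ≤ Real.log W := Real.log_nonneg hW1
  set V : ℝ := (logBarrier f η x₀ + W) / η + m * Real.log W with hV
  -- in the sublevel set of `x₀` every slack is at least `exp (-V)`
  have hlow : ∀ x ∈ strictlyFeasible f, logBarrier f η x ≤ logBarrier f η x₀ →
      ∀ i : Fin m, f i.succ x ≤ -Real.exp (-V) := by
    intro x hx hle i
    have hxf := strictlyFeasible_subset f hx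
    have hα : ∀ j : Fin m, 0 < -f j.succ x := fun j => neg_pos.2 (hx j)
    have hterm : ∀ j : Fin m, 0 ≤ Real.log W - Real.log (-f j.succ x) := fun j => by
      have h1 : -f j.succ x ≤ W := (neg_le_abs _).trans (hbW _ x hxf)
      linarith [Real.log_le_log (hα j) h1]
    have h1 := Finset.single_le_sum (f := fun j : Fin m => Real.log W - Real.log (-f j.succ x))
      (fun j _ => hterm j) (Finset.mem_univ i)
    rw [Finset.sum_sub_distrib, Finset.sum_const, Finset.card_fin, nsmul_eq_mul] at h1
    have h2 := (abs_le.1 (hbW 0 x hxf)).1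
    have h3 : -∑ j : Fin m, Real.log (-f j.succ x) ≤ (logBarrier f η x₀ + W) / η := by
      rw [le_div_iff₀ hη]
      rw [logBarrier, Finset.sum_neg_distrib] at hle
      linarith
    have h4 : -V ≤ Real.log (-f i.succ x) := by linarith
    have h5 := Real.exp_le_exp.2 h4
    rw [Real.exp_log (hα i)] at h5
    linarith
  set K : Set (Euc d) := {x | ∀ i : Fin m, f i.succ x ≤ -Real.exp (-V)} with hK
  have hKs : K ⊆ strictlyFeasible f := fun x hx i =>
    (hx i).trans_lt (neg_neg_of_pos (Real.exp_pos _))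
  have hKc : IsCompact K := by
    refine hc.of_isClosed_subset ?_ (hKs.trans (strictlyFeasible_subset f))
    have : K = ⋂ i : Fin m, {x | f i.succ x ≤ -Real.exp (-V)} := by ext x; simp [hK]
    rw [this]
    exact isClosed_iInter fun i => isClosed_le (hp.continuous _) continuous_const
  have hcont : ContinuousOn (logBarrier f η) K := by
    refine (hp.continuous 0).continuousOn.add (continuousOn_const.mul
      (continuousOn_finsetSum _ fun i _ => ?_))
    exact ((hp.continuous i.succ).neg.continuousOn.log
      fun x hx => neg_ne_zero.2 (hKs hx i).ne).neg
  obtain ⟨x, hxK, hx⟩ := hKc.exists_isMinOn ⟨x₀, hlow x₀ hx₀ le_rfl⟩ hcont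
  refine ⟨x, hKs hxK, fun y hy => ?_⟩
  by_cases hle : logBarrier f η y ≤ logBarrier f η x₀
  · exact hx (hlow y hy hle)
  · exact (hx (hlow x₀ hx₀ le_rfl)).trans (not_le.1 hle).le

lemma barrierMin_eq {η : ℝ} {x : Euc d} (hx : x ∈ strictlyFeasible f)
    (hmin : IsMinOn (logBarrier f η) (strictlyFeasible f) x) :
    barrierMin f η = logBarrier f η x := by
  refine IsLeast.csInf_eq ⟨Set.mem_image_of_mem _ hx, ?_⟩
  rintro _ ⟨y, hy, rfl⟩
  exact hmin hy

lemma ProblemAssumptions.norm_gradient_le (hp : ProblemAssumptions f x₀ L M R β ρ l)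
    (hL : ∀ i, 0 < L i) {x : Euc d} (hx : x ∈ strictlyFeasible f) (i : Fin (m + 1)) :
    ‖gradient (f i) x‖ ≤ ⨆ i, L i :=
  (norm_gradient_le_of_lipschitzOnSet (hL i).le (hp.lipschitz i)
    (feasibleSet_mem_nhds hp.continuous hx)).trans (le_ciSup (Finite.bddAbove_range L) i)

/-- The constant of MFCQ is at most the Lipschitz constant. A ray from `x₀` leaves the bounded
feasible set, hence passes a strictly feasible point with a slack below `ρ`. -/
lemma ProblemAssumptions.mfcq_le (hp : ProblemAssumptions f x₀ L M R β ρ l)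
    (hL : ∀ i, 0 < L i) (hρ : 0 < ρ) : l ≤ ⨆ i, L i := by
  have hx₀ := hp.start_mem hρ
  have hx₀f := strictlyFeasible_subset f hx₀
  obtain ⟨s, hs, -⟩ := hp.mfcq x₀ hx₀f
  have hR : 0 ≤ R := by simpa using hp.diameter x₀ hx₀f x₀ hx₀f
  have hex : ∃ i : Fin m, -(ρ / 2) ≤ f i.succ (x₀ + (R + 1) • s) := by
    by_contra! hcon
    have h1 : x₀ + (R + 1) • s ∈ feasibleSet f := fun i => by
      have := hcon i
      linarith
    have h2 := hp.diameter _ h1 _ hx₀f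
    rw [add_sub_cancel_left, norm_smul, hs, Real.norm_of_nonneg (by linarith)] at h2
    linarith
  obtain ⟨τ, -, hle, i, hi⟩ := exists_max_eq (φ := fun (i : Fin m) τ => f i.succ (x₀ + τ • s))
    (fun i => (hp.continuous i.succ).comp (by fun_prop)) (by linarith : 0 ≤ R + 1)
    (fun i => by
      have := hp.start i
      have := hp.rho_le
      simp only [zero_smul, add_zero]
      linarith) hex
  have hx : x₀ + τ • s ∈ strictlyFeasible f := fun i => (hle i).trans_lt (by linarith)
  obtain ⟨s', hs', hin⟩ := hp.mfcq _ (strictlyFeasible_subset f hx)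
  have h1 := hin i (by rw [hi]; linarith)
  have h2 := real_inner_le_norm s' (gradient (f i.succ) (x₀ + τ • s))
  rw [hs', one_mul] at h2
  exact h1.le.trans (h2.trans (hp.norm_gradient_le hL hx _))

end Barrier

/-! ### Steps of LB-SGD under small noise -/

/-- The factor by which relative noise is amplified in the estimate of the barrier gradient. -/
noncomputable def noiseGain (m : ℕ) (Lm c : ℝ) : ℝ := 12 + m * (12 / c + 6 * Lm / c ^ 2)

/-- The smallness conditions on the noise constant `κ`, where `c` is the distance constant and `Lm`
the largest Lipschitz constant: `slack` and `smooth` make the estimated slacks and slopes safe to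
use in the step size, `gain` and `gain'` bound the error of `g`, and `slope` bounds the overestimate
of the slopes. -/
structure IsNoiseConst (m : ℕ) (M : Fin (m + 1) → ℝ) (Lm c ρ κ : ℝ) : Prop where
  pos : 0 < κ
  le_one : κ ≤ 1
  slack : 240 * ρ * κ ≤ c
  smooth : ∀ i, 57600 * ρ * κ ≤ c * M i
  gain : 20 * noiseGain m Lm c * κ ≤ 1
  gain' : 20 * noiseGain m Lm c * ρ * κ ≤ Lm
  slope : 280 * ρ * κ ≤ Lm

lemma noiseGain_pos (m : ℕ) {Lm c : ℝ} (hL : 0 < Lm) (hc : 0 < c) : 0 < noiseGain m Lm c := by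
  unfold noiseGain; positivity

lemma exists_isNoiseConst (m : ℕ) {M : Fin (m + 1) → ℝ} {Lm c ρ : ℝ} (hM : ∀ i, 0 < M i)
    (hL : 0 < Lm) (hc : 0 < c) (hρ : 0 < ρ) : ∃ κ, IsNoiseConst m M Lm c ρ κ := by
  have hD := noiseGain_pos m hL hc
  set a : Fin (m + 1) → ℝ := fun i => 57600 * ρ / (c * M i) with ha
  have ha0 : ∀ i, 0 < a i := fun i => by have := hM i; positivity
  have hsum : 0 ≤ ∑ i, a i := Finset.sum_nonneg fun i _ => (ha0 i).le
  set A := 1 + 240 * ρ / c + ∑ i, a i + 20 * noiseGain m Lm c + 20 * noiseGain m Lm c * ρ / Lm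
    + 280 * ρ / Lm with hA
  have h1 : 0 < 240 * ρ / c := by positivity
  have h2 : 0 < 20 * noiseGain m Lm c * ρ / Lm := by positivity
  have h3 : 0 < 280 * ρ / Lm := by positivity
  have hA0 : 0 < A := by linarith
  have key : ∀ p q : ℝ, 0 < q → p / q ≤ A → p * A⁻¹ ≤ q := fun p q hq h => by
    rw [div_le_iff₀ hq] at h
    rw [← div_eq_mul_inv, div_le_iff₀ hA0]; linarith
  refine ⟨A⁻¹, inv_pos.2 hA0, inv_le_one_of_one_le₀ (by linarith), key _ _ hc (by linarith),
    fun i => key _ _ (by have := hM i; positivity) ?_, key _ _ one_pos (by rw [div_one]; linarith),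
    key _ _ hL (by linarith), key _ _ hL (by linarith)⟩
  have := Finset.single_le_sum (f := a) (fun i _ => (ha0 i).le) (Finset.mem_univ i)
  simp only [ha] at this
  linarith

lemma abs_inner_unit_le {E : Type*} [NormedAddCommGroup E] [InnerProductSpace ℝ E] (v g : E) :
    |inner ℝ v (‖g‖⁻¹ • g)| ≤ ‖v‖ := by
  have h1 : ‖(‖g‖⁻¹ • g)‖ ≤ 1 := by
    rw [norm_smul, norm_inv, norm_norm]; exact inv_mul_le_one
  exact (abs_real_inner_le_norm _ _).trans (mul_le_of_le_one_right (norm_nonneg _) h1)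

namespace LBSGD

variable {d m : ℕ} {Ξ : Type*} (A : LBSGD d m Ξ)

/-- The noise levels of the batch are small in terms of `κ`. -/
structure SmallNoise (κ : ℝ) : Prop where
  value_nonneg : ∀ i, 0 ≤ A.σn i * √(Real.log (1 / A.δ))
  value_le : ∀ i, A.σn i * √(Real.log (1 / A.δ)) ≤ κ * A.η ^ 2
  grad_nonneg : ∀ i, 0 ≤ A.σhatn i * √(Real.log (1 / A.δ))
  grad_le : ∀ i, A.σhatn i * √(Real.log (1 / A.δ)) ≤ κ * A.η
  bias_nonneg : ∀ i, 0 ≤ A.bhat i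
  bias_le : ∀ i, A.bhat i ≤ κ * A.η

/-- The batch `z` estimates values and gradients at `x` with errors `11 κ η ^ 2` and `12 κ η`. -/
structure IsAccurate (f : Fin (m + 1) → Euc d → ℝ) (κ : ℝ) (x : Euc d) (z : Fin A.n → Ξ) :
    Prop where
  value : ∀ i : Fin m, |A.Fn i.succ x z - f i.succ x| ≤ 11 * (κ * A.η ^ 2)
  grad : ∀ i, ‖A.Gn i x z - gradient (f i) x‖ ≤ 12 * (κ * A.η)

variable {A} {f : Fin (m + 1) → Euc d → ℝ} {κ c ρ Lm : ℝ} {x : Euc d} {z : Fin A.n → Ξ}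

lemma IsAccurate.abs_αlow_sub_le (ha : A.IsAccurate f κ x z) (hn : A.SmallNoise κ) (i : Fin m) :
    |A.αlow i x z - -f i.succ x| ≤ 12 * (κ * A.η ^ 2) := by
  have h1 := abs_le.1 (ha.value i)
  have h2 := hn.value_nonneg i.succ
  have h3 := hn.value_le i.succ
  rw [αlow, abs_le]
  constructor <;> linarith

lemma IsAccurate.abs_slope_le (ha : A.IsAccurate f κ x z) (hn : A.SmallNoise κ) (i : Fin m) :
    |inner ℝ (gradient (f i.succ) x) (‖A.g x z‖⁻¹ • A.g x z)| ≤
      A.θhat i x z + 12 * (κ * A.η) := by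
  have h1 := abs_inner_unit_le (A.Gn i.succ x z - gradient (f i.succ) x) (A.g x z)
  rw [inner_sub_left] at h1
  have h2 := abs_sub_abs_le_abs_sub (inner ℝ (gradient (f i.succ) x) (‖A.g x z‖⁻¹ • A.g x z))
    (inner ℝ (A.Gn i.succ x z) (‖A.g x z‖⁻¹ • A.g x z))
  rw [abs_sub_comm] at h2
  have h3 := ha.grad i.succ
  have h4 := hn.bias_nonneg i.succ
  have h5 := hn.grad_nonneg i.succ
  rw [θhat]
  linarith

lemma IsAccurate.θhat_le (ha : A.IsAccurate f κ x z) (hn : A.SmallNoise κ)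
    (hgrad : ∀ i, ‖gradient (f i) x‖ ≤ Lm) (i : Fin m) :
    A.θhat i x z ≤ Lm + 14 * (κ * A.η) := by
  have h1 := abs_inner_unit_le (A.Gn i.succ x z) (A.g x z)
  have h2 := norm_sub_norm_le (A.Gn i.succ x z) (gradient (f i.succ) x)
  have h3 := ha.grad i.succ
  have h4 := hn.bias_le i.succ
  have h5 := hn.grad_le i.succ
  have h6 := hgrad i.succ
  rw [θhat]
  linarith

lemma SmallNoise.θhat_nonneg (hn : A.SmallNoise κ) (x : Euc d) (z : Fin A.n → Ξ) (i : Fin m) :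
    0 ≤ A.θhat i x z := by
  have h4 := hn.bias_nonneg i.succ
  have h5 := hn.grad_nonneg i.succ
  rw [θhat]
  positivity

/-- The error of the estimated barrier gradient. -/
lemma IsAccurate.norm_g_sub_le (ha : A.IsAccurate f κ x z)
    (hη : 0 < A.η) (hηρ : A.η ≤ ρ) (hc : 0 < c) (hκ : IsNoiseConst m A.M Lm c ρ κ)
    (hgrad : ∀ i, ‖gradient (f i) x‖ ≤ Lm) (hslack : ∀ i : Fin m, 2 * c * A.η ≤ -f i.succ x) :
    ‖A.g x z - (gradient (f 0) x + A.η • slackGradient f Finset.univ x)‖ ≤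
      noiseGain m Lm c * κ * A.η := by
  have hκ0 := hκ.pos
  have hterm : ∀ i : Fin m, ‖(-A.Fn i.succ x z)⁻¹ • A.Gn i.succ x z
      - (-f i.succ x)⁻¹ • gradient (f i.succ) x‖ ≤ κ * (12 / c + 6 * Lm / c ^ 2) := by
    intro i
    set α := -f i.succ x with hα
    set φ := -A.Fn i.succ x z with hφ
    have hα2 := hslack i
    have hcη : 0 < c * A.η := by positivity
    have hv : |φ - α| ≤ 11 * (κ * A.η ^ 2) := by
      have := ha.value i
      rwa [hφ, hα, neg_sub_neg, abs_sub_comm]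
    have hsmall : 11 * (κ * A.η ^ 2) ≤ c * A.η := by
      have h1 : κ * A.η ≤ κ * ρ := by gcongr
      have h2 := hκ.slack
      have h3 : 11 * (κ * A.η) ≤ c := by nlinarith
      nlinarith
    have hφ2 : c * A.η ≤ φ := by have := (abs_le.1 hv).1; linarith
    have hφ0 : 0 < φ := hcη.trans_le hφ2
    have hα0 : 0 < α := by linarith
    have e : φ⁻¹ • A.Gn i.succ x z - α⁻¹ • gradient (f i.succ) x =
        φ⁻¹ • (A.Gn i.succ x z - gradient (f i.succ) x)
          + (-(φ - α) * (φ⁻¹ * α⁻¹)) • gradient (f i.succ) x := by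
      have : -(φ - α) * (φ⁻¹ * α⁻¹) = φ⁻¹ - α⁻¹ := by field_simp; ring
      rw [this, smul_sub, sub_smul]; abel
    have hφi : φ⁻¹ ≤ (c * A.η)⁻¹ := inv_anti₀ hcη hφ2
    have hαi : α⁻¹ ≤ (2 * c * A.η)⁻¹ := inv_anti₀ (by positivity) hα2
    rw [e]
    refine (norm_add_le _ _).trans ?_
    rw [norm_smul, norm_smul, Real.norm_eq_abs, Real.norm_eq_abs, abs_mul, abs_neg,
      abs_of_pos (inv_pos.2 hφ0), abs_of_pos (mul_pos (inv_pos.2 hφ0) (inv_pos.2 hα0))]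
    calc φ⁻¹ * ‖A.Gn i.succ x z - gradient (f i.succ) x‖
          + |φ - α| * (φ⁻¹ * α⁻¹) * ‖gradient (f i.succ) x‖
        ≤ (c * A.η)⁻¹ * (12 * (κ * A.η))
          + 11 * (κ * A.η ^ 2) * ((c * A.η)⁻¹ * (2 * c * A.η)⁻¹) * Lm := by
          have := ha.grad i.succ
          have := hgrad i.succ
          gcongr
      _ = κ * (12 / c + 11 / 2 * Lm / c ^ 2) := by field_simp
      _ ≤ κ * (12 / c + 6 * Lm / c ^ 2) := by
          have hL0 : 0 ≤ Lm := (norm_nonneg _).trans (hgrad 0)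
          gcongr; norm_num
  have e : A.g x z - (gradient (f 0) x + A.η • slackGradient f Finset.univ x) =
      (A.Gn 0 x z - gradient (f 0) x) + A.η • ∑ i : Fin m, ((-A.Fn i.succ x z)⁻¹ • A.Gn i.succ x z
      - (-f i.succ x)⁻¹ • gradient (f i.succ) x) := by
    rw [g, slackGradient, Finset.sum_sub_distrib, smul_sub]; abel
  rw [e]
  refine (norm_add_le _ _).trans ?_
  rw [norm_smul, Real.norm_of_nonneg hη.le]
  have h1 := norm_sum_le_of_le Finset.univ fun i (_ : i ∈ Finset.univ) => hterm i
  rw [Finset.sum_const, Finset.card_fin, nsmul_eq_mul] at h1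
  have h2 := mul_le_mul_of_nonneg_left h1 hη.le
  have h3 := ha.grad 0
  rw [noiseGain]
  linarith

/-- Under small noise the slack estimates are within a factor `21 / 20`. -/
lemma IsAccurate.αlow_bounds (ha : A.IsAccurate f κ x z) (hn : A.SmallNoise κ)
    (hη : 0 < A.η) (hηρ : A.η ≤ ρ) (hκ : IsNoiseConst m A.M Lm c ρ κ)
    (hslack : ∀ i : Fin m, 2 * c * A.η ≤ -f i.succ x) (i : Fin m) :
    c * A.η ≤ A.αlow i x z ∧ A.αlow i x z ≤ 21 / 20 * -f i.succ x := by
  have hκ0 := hκ.pos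
  have h := abs_le.1 (ha.abs_αlow_sub_le hn i)
  have h0 := hslack i
  have hsmall : 20 * (12 * (κ * A.η ^ 2)) ≤ c * A.η := by
    have h1 : κ * A.η ≤ κ * ρ := by gcongr
    have h2 := hκ.slack
    have h3 : 240 * (κ * A.η) ≤ c := by nlinarith
    nlinarith
  have : 0 ≤ κ * A.η ^ 2 := by positivity
  constructor <;> linarith

/-- The step computed from an accurate batch is safe, and at most the inverse of the estimated
smoothness constant. -/
lemma IsAccurate.isSafeStep (ha : A.IsAccurate f κ x z) (hn : A.SmallNoise κ)
    (hη : 0 < A.η) (hηρ : A.η ≤ ρ) (hc : 0 < c) (hκ : IsNoiseConst m A.M Lm c ρ κ)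
    (hM : ∀ i, 0 < A.M i) (hx : x ∈ strictlyFeasible f)
    (hslack : ∀ i : Fin m, 2 * c * A.η ≤ -f i.succ x) (hg : A.g x z ≠ 0) :
    IsSafeStep f A.M x (A.g x z) (A.γ x z) (fun i => A.αlow i x z) (fun i => A.θhat i x z) ∧
    A.γ x z * A.M2hat x z ≤ 1 := by
  have hκ0 := hκ.pos
  have hcη : 0 < c * A.η := by positivity
  have hα := fun i => ha.αlow_bounds hn hη hηρ hκ hslack i
  have hα0 : ∀ i, 0 < A.αlow i x z := fun i => hcη.trans_le (hα i).1
  have hθ := hn.θhat_nonneg x z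
  have hgn : 0 < ‖A.g x z‖ := norm_pos_iff.2 hg
  have hM2 : 0 < A.M2hat x z := by
    have h1 : 0 ≤ ∑ i : Fin m, A.M i.succ / A.αlow i x z :=
      Finset.sum_nonneg fun i _ => (div_pos (hM _) (hα0 i)).le
    have h2 : 0 ≤ ∑ i : Fin m, A.θhat i x z ^ 2 / A.αlow i x z ^ 2 :=
      Finset.sum_nonneg fun i _ => by positivity
    have h3 := hM 0
    rw [M2hat]; positivity
  have hden : ∀ i, 0 < 2 * |A.θhat i x z| + √(A.αlow i x z * A.M i.succ) := fun i => by
    have := hα0 i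
    have := hM i.succ
    positivity
  have hratio : ∀ i : Fin m,
      0 ≤ A.αlow i x z / (2 * |A.θhat i x z| + √(A.αlow i x z * A.M i.succ)) := fun i =>
    (div_pos (hα0 i) (hden i)).le
  refine ⟨⟨hx, hg, ?_, hα0, hθ, fun i => (hα i).2, fun i => ?_, fun i => ?_⟩, ?_⟩
  · exact le_min (mul_nonneg (Real.iInf_nonneg hratio) (by positivity)) (by positivity)
  · refine (ha.abs_slope_le hn i).trans (add_le_add le_rfl ?_)
    rw [le_div_iff₀ (by norm_num)]
    refine Real.le_sqrt_of_sq_le ?_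
    -- the noise in the slope is of order `η`, the square root is at least of order `√η`
    have h1 := hκ.smooth i.succ
    have hρ0 : 0 ≤ ρ := hη.le.trans hηρ
    have h2 : κ * κ ≤ κ * 1 := by have := hκ.le_one; gcongr
    calc (12 * (κ * A.η) * 20) ^ 2 = 57600 * A.η * (κ * κ) * A.η := by ring
      _ ≤ 57600 * ρ * (κ * 1) * A.η := by gcongr
      _ = 57600 * ρ * κ * A.η := by ring
      _ ≤ c * A.M i.succ * A.η := by gcongr
      _ = c * A.η * A.M i.succ := by ring
      _ ≤ A.αlow i x z * A.M i.succ := by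
        have := hM i.succ
        have := (hα i).1
        gcongr
  · have h1 : A.γ x z ≤ A.αlow i x z / (2 * |A.θhat i x z| + √(A.αlow i x z * A.M i.succ))
        * (1 / ‖A.g x z‖) :=
      (min_le_left _ _).trans (mul_le_mul_of_nonneg_right
        (ciInf_le (Finite.bddBelow_range _) i) (by positivity))
    rw [mul_one_div, div_div, le_div_iff₀ (mul_pos (hden i) hgn), abs_of_nonneg (hθ i)] at h1
    linarith
  · have h1 : A.γ x z ≤ 1 / A.M2hat x z := min_le_right _ _
    rwa [le_div_iff₀ hM2] at h1

end LBSGD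

lemma distConst_pos {m : ℕ} {L : Fin (m + 1) → ℝ} {l : ℝ} (hL : 0 < ⨆ i, L i) (hl : 0 < l) :
    0 < distConst L l := by
  unfold distConst; positivity

/-- The bound of `SlackProducts` for a single slack, in terms of the constant `c`. -/
lemma inv_sqrt_pow_eq {m : ℕ} (L : Fin (m + 1) → ℝ) {l : ℝ} (hL : 0 < ⨆ i, L i) (hl : 0 < l) :
    ((√(4 * (⨆ i, L i) * (2 * m + 1) / l)) ^ (2 * m))⁻¹ = 2 * distConst L l := by
  rw [pow_mul, Real.sq_sqrt (by positivity), distConst, ← inv_pow, inv_div]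
  ring

lemma stepConst_pos {m : ℕ} {L M : Fin (m + 1) → ℝ} {l η : ℝ} (hL : 0 < ⨆ i, L i) (hl : 0 < l) :
    0 < stepConst L M l η := by
  have hc := distConst_pos hL hl
  have : 0 < max (4 + 5 * (⨆ i, M i) * distConst L l * η / (⨆ i, L i) ^ 2)
      (1 + √((⨆ i, M i) * distConst L l * η / (4 * (⨆ i, L i) ^ 2))) :=
    lt_max_of_lt_right (by positivity)
  unfold stepConst
  positivity

/-- The two inequalities that the constant `C` is made for: one for the length of the step, one for
the smoothness constant. -/
lemma stepConst_mul_le {m : ℕ} {L M : Fin (m + 1) → ℝ} {l η : ℝ} (hL : 0 < ⨆ i, L i) (hl : 0 < l)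
    (hM : 0 < ⨆ i, M i) (hη : 0 < η) :
    stepConst L M l η * ((⨆ i, L i) * (1 + m / distConst L l) *
      (2 * (⨆ i, L i) + √((⨆ i, M i) * (distConst L l * η)))) ≤ distConst L l ∧
    stepConst L M l η * ((1 + m / distConst L l) *
      (8 * (⨆ i, L i) ^ 2 / distConst L l + 10 * (⨆ i, M i) * η)) ≤ 1 := by
  have hc := distConst_pos hL hl
  set c := distConst L l with hcdef
  set Lm := ⨆ i, L i with hLm
  set Mm := ⨆ i, M i with hMm
  set P := 4 + 5 * Mm * c * η / Lm ^ 2 with hP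
  set Q := 1 + √(Mm * c * η / (4 * Lm ^ 2)) with hQ
  have hmax : 0 < max P Q := lt_max_of_lt_right (by positivity)
  have hC : stepConst L M l η = c / (2 * Lm ^ 2 * (1 + m / c)) * (1 / max P Q) := rfl
  have hD : 0 < 1 + m / c := by positivity
  constructor
  · have hs : √(Mm * (c * η)) = 2 * Lm * √(Mm * c * η / (4 * Lm ^ 2)) := by
      rw [show Mm * (c * η) = (2 * Lm) ^ 2 * (Mm * c * η / (4 * Lm ^ 2)) by field_simp; ring,
        Real.sqrt_mul (by positivity), Real.sqrt_sq (by positivity)]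
    have e : stepConst L M l η * (Lm * (1 + m / c) * (2 * Lm + √(Mm * (c * η)))) =
        c * (Q / max P Q) := by
      rw [hs, hC, hQ]; field_simp
    rw [e]
    exact mul_le_of_le_one_right hc.le ((div_le_one hmax).2 (le_max_right _ _))
  · have e : stepConst L M l η * ((1 + m / c) * (8 * Lm ^ 2 / c + 10 * Mm * η)) =
        P / max P Q := by
      rw [hC, hP]; field_simp; ring
    rw [e]
    exact (div_le_one hmax).2 (le_max_left _ _)

lemma div_add_sqrt_mono {a b B M : ℝ} (ha : 0 < a) (hab : a ≤ b) (hB : 0 ≤ B) (hM : 0 < M) :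
    a / (B + √(a * M)) ≤ b / (B + √(b * M)) := by
  have hb : 0 < b := ha.trans_le hab
  rw [div_le_div_iff₀ (by positivity) (by positivity), Real.sqrt_mul ha.le, Real.sqrt_mul hb.le]
  have h1 : √a ≤ √b := Real.sqrt_le_sqrt hab
  have h2 : a * √b ≤ b * √a := by
    have h3 : a * √b = √a * √b * √a := by
      nth_rw 1 [← Real.mul_self_sqrt ha.le]; ring
    have h4 : b * √a = √a * √b * √b := by
      nth_rw 1 [← Real.mul_self_sqrt hb.le]; ring
    rw [h3, h4]; gcongr
  have h5 := mul_le_mul_of_nonneg_right h2 (Real.sqrt_nonneg M)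
  have h6 := mul_le_mul_of_nonneg_right hab hB
  linarith

namespace LBSGD

variable {d m : ℕ} {Ξ : Type*} {A : LBSGD d m Ξ} {f : Fin (m + 1) → Euc d → ℝ}
  {κ ρ l : ℝ} {L : Fin (m + 1) → ℝ} {x : Euc d} {z : Fin A.n → Ξ}

lemma norm_barrierGradient_le {Lm c η : ℝ} (hη : 0 < η) (hc : 0 < c)
    (hgrad : ∀ i, ‖gradient (f i) x‖ ≤ Lm) (hslack : ∀ i : Fin m, 2 * c * η ≤ -f i.succ x) :
    ‖gradient (f 0) x + η • slackGradient f Finset.univ x‖ ≤ Lm * (1 + m / c) := by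
  have hL0 : 0 ≤ Lm := (norm_nonneg _).trans (hgrad 0)
  have hterm : ∀ i : Fin m, ‖(-f i.succ x)⁻¹ • gradient (f i.succ) x‖ ≤ (c * η)⁻¹ * Lm := by
    intro i
    have h0 := hslack i
    have hcη : 0 < c * η := by positivity
    have hα : 0 < -f i.succ x := by linarith
    rw [norm_smul, norm_inv, Real.norm_of_nonneg hα.le]
    have h1 : (-f i.succ x)⁻¹ ≤ (c * η)⁻¹ := inv_anti₀ hcη (by linarith)
    exact mul_le_mul h1 (hgrad _) (norm_nonneg _) (by positivity)
  have h1 := norm_sum_le_of_le Finset.univ fun i (_ : i ∈ Finset.univ) => hterm i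
  rw [Finset.sum_const, Finset.card_fin, nsmul_eq_mul] at h1
  refine (norm_add_le _ _).trans ?_
  rw [norm_smul, Real.norm_of_nonneg hη.le, slackGradient]
  have h2 := mul_le_mul_of_nonneg_left h1 hη.le
  have e : η * (m * ((c * η)⁻¹ * Lm)) = Lm * (m / c) := by field_simp
  have := hgrad 0
  linarith

/-- Lower bound on the adaptive step size. -/
lemma IsAccurate.le_γ (ha : A.IsAccurate f κ x z) (hn : A.SmallNoise κ) (hm : 1 ≤ m)
    (hη : 0 < A.η) (hηρ : A.η ≤ ρ) (hL : 0 < ⨆ i, L i) (hl : 0 < l)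
    (hκ : IsNoiseConst m A.M (⨆ i, L i) (distConst L l) ρ κ)
    (hM : ∀ i, 0 < A.M i) (hgrad : ∀ i, ‖gradient (f i) x‖ ≤ ⨆ i, L i)
    (hslack : ∀ i : Fin m, 2 * distConst L l * A.η ≤ -f i.succ x) (hg : A.g x z ≠ 0) :
    9 / 10 * (stepConst L A.M l A.η * A.η) ≤ A.γ x z := by
  have hMle : ∀ i, A.M i ≤ ⨆ i, A.M i := fun i => le_ciSup (Finite.bddAbove_range A.M) i
  have hMm : 0 < ⨆ i, A.M i := (hM 0).trans_le (hMle 0)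
  have hc := distConst_pos hL hl
  obtain ⟨hC1, hC2⟩ := stepConst_mul_le hL hl hMm hη
  have hC0 : 0 < stepConst L A.M l A.η := stepConst_pos hL hl
  set C := stepConst L A.M l A.η
  set c := distConst L l
  set Lm := ⨆ i, L i
  set Mm := ⨆ i, A.M i
  have hκ0 := hκ.pos
  have hcη : 0 < c * A.η := by positivity
  have hα := fun i => (ha.αlow_bounds hn hη hηρ hκ hslack i).1
  have hα0 : ∀ i, 0 < A.αlow i x z := fun i => hcη.trans_le (hα i)
  have hθ := hn.θhat_nonneg x z
  have hκη : κ * A.η ≤ κ * ρ := by gcongr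
  have hθ2 : ∀ i, A.θhat i x z ≤ 21 / 20 * Lm := fun i => by
    have h1 := ha.θhat_le hn hgrad i
    have h2 := hκ.slope
    linarith
  have hgn : 0 < ‖A.g x z‖ := norm_pos_iff.2 hg
  have hD : 1 ≤ 1 + m / c := le_add_of_nonneg_right (by positivity)
  have hgn2 : ‖A.g x z‖ ≤ 21 / 20 * (Lm * (1 + m / c)) := by
    have h1 := ha.norm_g_sub_le hη hηρ hc hκ hgrad hslack
    have h2 := norm_barrierGradient_le (f := f) hη hc hgrad hslack
    have h3 := hκ.gain'
    have h4 : noiseGain m Lm c * κ * A.η ≤ noiseGain m Lm c * κ * ρ := by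
      have := noiseGain_pos m hL hc
      gcongr
    have h5 := norm_sub_norm_le (A.g x z) (gradient (f 0) x + A.η • slackGradient f Finset.univ x)
    have h6 : Lm ≤ Lm * (1 + m / c) := le_mul_of_one_le_right hL.le hD
    linarith
  refine le_min ?_ ?_
  · have : Nonempty (Fin m) := ⟨⟨0, hm⟩⟩
    set W := 2 * Lm + √(Mm * (c * A.η)) with hW
    have hW0 : 0 < W := by positivity
    have hratio : c * A.η / (21 / 20 * W) ≤
        ⨅ i : Fin m, A.αlow i x z / (2 * |A.θhat i x z| + √(A.αlow i x z * A.M i.succ)) := by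
      refine le_ciInf fun i => ?_
      rw [abs_of_nonneg (hθ i)]
      have h0 := hα0 i
      have h1 := hM i.succ
      have h2 := hθ i
      calc c * A.η / (21 / 20 * W) ≤ c * A.η / (21 / 10 * Lm + √(c * A.η * Mm)) := by
            apply div_le_div_of_nonneg_left hcη.le (by positivity)
            rw [hW, mul_comm (c * A.η)]
            linarith [Real.sqrt_nonneg (Mm * (c * A.η))]
        _ ≤ A.αlow i x z / (21 / 10 * Lm + √(A.αlow i x z * Mm)) :=
            div_add_sqrt_mono hcη (hα i) (by positivity) hMm
        _ ≤ _ := by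
            apply div_le_div_of_nonneg_left h0.le
            · have : 0 < √(A.αlow i x z * A.M i.succ) := Real.sqrt_pos.2 (by positivity)
              linarith
            · have h3 : √(A.αlow i x z * A.M i.succ) ≤ √(A.αlow i x z * Mm) :=
                Real.sqrt_le_sqrt (mul_le_mul_of_nonneg_left (hMle _) h0.le)
              have := hθ2 i
              linarith
    have h1 : 1 / (21 / 20 * (Lm * (1 + m / c))) ≤ 1 / ‖A.g x z‖ :=
      one_div_le_one_div_of_le hgn hgn2
    refine le_trans ?_ (mul_le_mul hratio h1 (by positivity) (le_trans (by positivity) hratio))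
    rw [mul_one_div, div_div, le_div_iff₀ (by positivity)]
    have h2 := mul_le_mul_of_nonneg_right hC1 hη.le
    have h3 : 0 ≤ C * (Lm * (1 + m / c) * W) * A.η := by positivity
    linarith
  · have hs1 : ∑ i : Fin m, A.M i.succ / A.αlow i x z ≤ m * (Mm / (c * A.η)) := by
      refine (Finset.sum_le_sum fun i _ => div_le_div₀ hMm.le (hMle i.succ) hcη (hα i)).trans ?_
      simp
    have hs2 : ∑ i : Fin m, A.θhat i x z ^ 2 / A.αlow i x z ^ 2 ≤
        m * ((21 / 20 * Lm) ^ 2 / (c * A.η) ^ 2) := by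
      refine (Finset.sum_le_sum fun i _ => div_le_div₀ (by positivity)
        (pow_le_pow_left₀ (hθ i) (hθ2 i) 2) (by positivity)
        (pow_le_pow_left₀ hcη.le (hα i) 2)).trans ?_
      simp
    have hs1' : 0 ≤ ∑ i : Fin m, A.M i.succ / A.αlow i x z :=
      Finset.sum_nonneg fun i _ => (div_pos (hM _) (hα0 i)).le
    have hs2' : 0 ≤ ∑ i : Fin m, A.θhat i x z ^ 2 / A.αlow i x z ^ 2 :=
      Finset.sum_nonneg fun i _ => by positivity
    have hM2 : 0 < A.M2hat x z := by
      have h3 := hM 0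
      rw [M2hat]; positivity
    have hM2le : A.M2hat x z * A.η ≤
        441 / 400 * ((1 + m / c) * (8 * Lm ^ 2 / c + 10 * Mm * A.η)) := by
      have h0 := hMle 0
      have h1 : A.M2hat x z ≤ Mm + 10 * A.η * (m * (Mm / (c * A.η)))
          + 8 * A.η * (m * ((21 / 20 * Lm) ^ 2 / (c * A.η) ^ 2)) := by
        rw [M2hat]; gcongr
      have h2 := mul_le_mul_of_nonneg_right h1 hη.le
      have e : (Mm + 10 * A.η * (m * (Mm / (c * A.η)))
          + 8 * A.η * (m * ((21 / 20 * Lm) ^ 2 / (c * A.η) ^ 2))) * A.η =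
          Mm * A.η + 10 * (m / c * (Mm * A.η)) + 441 / 50 * (m / c * (Lm ^ 2 / c)) := by
        field_simp; ring
      have e' : 441 / 400 * ((1 + m / c) * (8 * Lm ^ 2 / c + 10 * Mm * A.η)) =
          441 / 50 * (Lm ^ 2 / c) + 441 / 40 * (Mm * A.η) + 441 / 50 * (m / c * (Lm ^ 2 / c))
            + 441 / 40 * (m / c * (Mm * A.η)) := by ring
      have p1 : 0 ≤ Lm ^ 2 / c := by positivity
      have p2 : 0 ≤ Mm * A.η := by positivity
      have p3 : 0 ≤ m / c * (Mm * A.η) := by positivity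
      rw [e] at h2
      rw [e']
      linarith
    rw [le_div_iff₀ hM2]
    have h1 := mul_le_mul_of_nonneg_left hM2le hC0.le
    linarith

/-- The per-step facts that drive the analysis, for an accurate batch at a point with controlled
slacks where the stopping criterion fails: the next point is strictly feasible with controlled
slacks, and the barrier decreases by `C η ^ 3 / 10`. -/
lemma IsAccurate.step (ha : A.IsAccurate f κ x z) (hn : A.SmallNoise κ) {x₀ : Euc d} {R β : ℝ}
    (hp : ProblemAssumptions f x₀ L A.M R β ρ l) (hm : 1 ≤ m) (hLi : ∀ i, 0 < L i)
    (hl : 0 < l) (hρ : 0 < ρ) (hη : 0 < A.η) (hηρ : A.η ≤ ρ)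
    (hκ : IsNoiseConst m A.M (⨆ i, L i) (distConst L l) ρ κ)
    (hM : ∀ i, 0 < A.M i) (hx : x ∈ strictlyFeasible f)
    (hprod : SlackProducts f A.η √(4 * (⨆ i, L i) * (2 * m + 1) / l) x)
    (hg : 3 * A.η / 4 < ‖A.g x z‖) :
    x - A.γ x z • A.g x z ∈ strictlyFeasible f ∧
    SlackProducts f A.η √(4 * (⨆ i, L i) * (2 * m + 1) / l) (x - A.γ x z • A.g x z) ∧
    logBarrier f A.η (x - A.γ x z • A.g x z) ≤
      logBarrier f A.η x - stepConst L A.M l A.η * A.η ^ 3 / 10 := by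
  have hL : 0 < ⨆ i, L i := (hLi 0).trans_le (le_ciSup (Finite.bddAbove_range L) 0)
  have hlL := hp.mfcq_le hLi hρ
  have hc := distConst_pos hL hl
  have hgrad := fun i => hp.norm_gradient_le hLi hx i
  have hslack : ∀ i : Fin m, 2 * distConst L l * A.η ≤ -f i.succ x := fun i => by
    rw [← inv_sqrt_pow_eq L hL hl]; exact hprod.le_slack hη i
  have hgn : 0 < ‖A.g x z‖ := lt_trans (by positivity) hg
  have hg0 : A.g x z ≠ 0 := norm_pos_iff.1 hgn
  obtain ⟨hs, hγM⟩ := ha.isSafeStep hn hη hηρ hc hκ hM hx hslack hg0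
  have hγ := ha.le_γ hn hm hη hηρ hL hl hκ hM hgrad hslack hg0
  have herr := ha.norm_g_sub_le hη hηρ hc hκ hgrad hslack
  have hgain := hκ.gain
  have hgain' := hκ.gain'
  have hG0 := noiseGain_pos m hL hc
  have hκ0 := hκ.pos
  have hC0 : 0 < stepConst L A.M l A.η := stepConst_pos hL hl
  have herr1 : noiseGain m (⨆ i, L i) (distConst L l) * κ * A.η ≤ (⨆ i, L i) / 20 := by
    have : noiseGain m (⨆ i, L i) (distConst L l) * κ * A.η ≤
      noiseGain m (⨆ i, L i) (distConst L l) * κ * ρ := by gcongr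
    linarith
  have herr2 : noiseGain m (⨆ i, L i) (distConst L l) * κ * A.η ≤ A.η / 20 := by nlinarith
  refine ⟨(hs.slack_next hp.continuous hM hp.smooth).1, ?_, ?_⟩
  · exact hprod.next hs hp.continuous hM hp.smooth hη hηρ hγM hp.mfcq hgrad hl hlL
      (Real.sqrt_pos.2 (by positivity)) (Real.sq_sqrt (by positivity)) (herr.trans herr1)
  · refine (hs.logBarrier_next hp.continuous hM hp.smooth hη hγM).trans ?_
    set D := gradient (f 0) x + A.η • slackGradient f Finset.univ x
    set g' := A.g x z
    have h1 : ‖g'‖ ^ 2 - inner ℝ D g' ≤ ‖g' - D‖ * ‖g'‖ := by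
      rw [← real_inner_self_eq_norm_sq, ← inner_sub_left]
      exact real_inner_le_norm _ _
    have h2 : ‖g' - D‖ * ‖g'‖ ≤ ‖g'‖ / 15 * ‖g'‖ := by
      refine mul_le_mul_of_nonneg_right ?_ hgn.le
      linarith
    have h3 : 13 / 30 * ‖g'‖ ^ 2 ≤ inner ℝ D g' - ‖g'‖ ^ 2 / 2 := by linarith
    have h4 : 9 / 16 * A.η ^ 2 ≤ ‖g'‖ ^ 2 := by
      have : (3 * A.η / 4) ^ 2 ≤ ‖g'‖ ^ 2 := by gcongr
      linarith
    have h5 : 9 / 10 * (stepConst L A.M l A.η * A.η) * (13 / 30 * (9 / 16 * A.η ^ 2)) ≤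
        A.γ x z * (inner ℝ D g' - ‖g'‖ ^ 2 / 2) :=
      mul_le_mul hγ ((mul_le_mul_of_nonneg_left h4 (by norm_num)).trans h3) (by positivity)
        hs.γ_nonneg
    have h6 : 0 ≤ stepConst L A.M l A.η * A.η ^ 3 := by positivity
    linarith

end LBSGD

/-! ### The whole run -/

namespace LBSGD

variable {d m : ℕ} {Ξ : Type*} {A : LBSGD d m Ξ} {f : Fin (m + 1) → Euc d → ℝ}
  {κ ρ l R β : ℝ} {L : Fin (m + 1) → ℝ} {z : ℕ → Fin A.n → Ξ} {T : ℕ}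

/-- As long as the stopping criterion fails, the iterates keep their distance from the boundary and
the barrier decreases at a constant rate. -/
lemma iterate_invariant (hn : A.SmallNoise κ)
    (hp : ProblemAssumptions f A.x₀ L A.M R β ρ l) (hm : 1 ≤ m) (hLi : ∀ i, 0 < L i)
    (hl : 0 < l) (hρ : 0 < ρ) (hη : 0 < A.η) (hηρ : A.η ≤ ρ)
    (hκ : IsNoiseConst m A.M (⨆ i, L i) (distConst L l) ρ κ) (hM : ∀ i, 0 < A.M i)
    (hacc : ∀ t < T, A.iterate z t ∈ feasibleSet f → A.IsAccurate f κ (A.iterate z t) (z t))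
    {t : ℕ} (ht : t ≤ T) (hrun : ∀ s < t, 3 * A.η / 4 < ‖A.gAt z s‖) :
    A.iterate z t ∈ strictlyFeasible f ∧
    SlackProducts f A.η √(4 * (⨆ i, L i) * (2 * m + 1) / l) (A.iterate z t) ∧
    logBarrier f A.η (A.iterate z t) ≤
      logBarrier f A.η A.x₀ - t * (stepConst L A.M l A.η * A.η ^ 3 / 10) := by
  induction t with
  | zero =>
    have hx₀ := hp.start_mem hρ
    refine ⟨hx₀, slackProducts_of_le hη ?_ fun i => ?_, by simp [iterate]⟩
    · rw [Real.one_le_sqrt, one_le_div hl]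
      have h1 := hp.mfcq_le hLi hρ
      have h2 : (0 : ℝ) ≤ m := Nat.cast_nonneg m
      nlinarith
    · have := hp.start i
      have := hp.rho_le
      rw [iterate]
      linarith
  | succ t ih =>
    obtain ⟨hx, hprod, hB⟩ := ih (by omega) fun s hs => hrun s (by omega)
    obtain ⟨h1, h2, h3⟩ := (hacc t (by omega) (strictlyFeasible_subset f hx)).step hn hp hm hLi
      hl hρ hη hηρ hκ hM hx hprod (hrun t (by omega))
    refine ⟨h1, h2, h3.trans ?_⟩
    push_cast
    linarith

/-- The conclusions about a run in which all batches are accurate. -/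
lemma run_of_isAccurate (hn : A.SmallNoise κ)
    (hp : ProblemAssumptions f A.x₀ L A.M R β ρ l) (hm : 1 ≤ m) (hLi : ∀ i, 0 < L i)
    (hl : 0 < l) (hρ : 0 < ρ) (hη : 0 < A.η) (hηρ : A.η ≤ ρ)
    (hκ : IsNoiseConst m A.M (⨆ i, L i) (distConst L l) ρ κ) (hM : ∀ i, 0 < A.M i)
    (hacc : ∀ t < T, A.iterate z t ∈ feasibleSet f → A.IsAccurate f κ (A.iterate z t) (z t))
    (hT : 0 < T) (hTge : iterBound f A.x₀ L A.M l A.η ≤ T) :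
    ∃ k < T, A.StopsAt z k ∧ (k : ℝ) ≤ iterBound f A.x₀ L A.M l A.η ∧
      ∀ j, A.IsOutputIndex z k j → A.iterate z j ∈ strictlyFeasible f ∧
        ‖gradient (logBarrier f A.η) (A.iterate z j)‖ ≤ A.η ∧
        IsApproxKKT f A.η (A.iterate z j) := by
  have hinv := fun {t : ℕ} => iterate_invariant (t := t) hn hp hm hLi hl hρ hη hηρ hκ hM hacc
  have hL : 0 < ⨆ i, L i := (hLi 0).trans_le (le_ciSup (Finite.bddAbove_range L) 0)
  have hc := distConst_pos hL hl
  have hC : 0 < stepConst L A.M l A.η * A.η ^ 3 := mul_pos (stepConst_pos hL hl) (by positivity)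
  obtain ⟨y, hy, hmin⟩ := hp.exists_isMinOn hρ hη
  have hBmin := barrierMin_eq hy hmin
  have hB0 : 0 ≤ logBarrier f A.η A.x₀ - barrierMin f A.η := by
    rw [hBmin]; exact sub_nonneg.2 (hmin (hp.start_mem hρ))
  -- the number of steps made so far is bounded by the total decrease of the barrier
  have hcount : ∀ t ≤ T, (∀ s < t, 3 * A.η / 4 < ‖A.gAt z s‖) →
      t * (stepConst L A.M l A.η * A.η ^ 3) ≤
        10 * (logBarrier f A.η A.x₀ - barrierMin f A.η) := by
    intro t ht hrun
    obtain ⟨h1, -, h2⟩ := hinv ht hrun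
    have h3 : barrierMin f A.η ≤ logBarrier f A.η (A.iterate z t) := by
      rw [hBmin]; exact hmin h1
    linarith
  have hex : ∃ k, k < T ∧ ‖A.gAt z k‖ ≤ 3 * A.η / 4 := by
    by_contra! hcon
    have h1 := hcount T le_rfl hcon
    rw [iterBound, div_le_iff₀ hC] at hTge
    have hT' : (0 : ℝ) < T := by exact_mod_cast hT
    have := mul_pos hT' hC
    linarith
  classical
  obtain ⟨hkT, hk⟩ := Nat.find_spec hex
  have hbefore : ∀ s < Nat.find hex, 3 * A.η / 4 < ‖A.gAt z s‖ := fun s hs => by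
    have := Nat.find_min hex hs
    push Not at this
    exact this (hs.trans hkT)
  refine ⟨Nat.find hex, hkT, ⟨hk, hbefore⟩, ?_, ?_⟩
  · rw [iterBound, le_div_iff₀ hC]
    have := hcount _ hkT.le hbefore
    linarith
  · rintro j ⟨hjk, hjmin⟩
    obtain ⟨hx, hprod, -⟩ := hinv (hjk.trans hkT.le) fun s hs => hbefore s (hs.trans_le hjk)
    have hd : ∀ i, DifferentiableAt ℝ (f i) (A.iterate z j) := fun i =>
      (hp.smooth i).1 _ (strictlyFeasible_subset f hx)
    have hgrad : ‖gradient (logBarrier f A.η) (A.iterate z j)‖ ≤ A.η := by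
      rw [gradient_logBarrier hx hd]
      have ha := hacc j (hjk.trans_lt hkT) (strictlyFeasible_subset f hx)
      have h1 := ha.norm_g_sub_le hη hηρ hc hκ (hp.norm_gradient_le hLi hx) fun i => by
        rw [← inv_sqrt_pow_eq L hL hl]; exact hprod.le_slack hη i
      have h2 : ‖A.g (A.iterate z j) (z j)‖ ≤ 3 * A.η / 4 := (hjmin _ le_rfl).trans hk
      have h3 := norm_le_norm_add_norm_sub (A.g (A.iterate z j) (z j)) (gradient (f 0)
        (A.iterate z j) + A.η • slackGradient f Finset.univ (A.iterate z j))
      have h4 := mul_le_mul_of_nonneg_right hκ.gain hη.le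
      linarith
    exact ⟨hx, hgrad, isApproxKKT_of_gradient_logBarrier hx hd hη.le hgrad⟩

end LBSGD

section Run

variable {d m : ℕ} {Ξ Ω : Type*} [MeasurableSpace Ξ] [MeasurableSpace Ω]
    {A : LBSGD d m Ξ} {f : Fin (m + 1) → Euc d → ℝ} {ν : Measure Ξ} {μ : Measure Ω}
    {ξ : ℕ → Fin A.n → Ω → Ξ} {L : Fin (m + 1) → ℝ} {R β ρ l : ℝ} {T : ℕ} {δhat : ℝ}

/-- The range of `δ` excludes `m = 0`, where `δhat / (m * T)` is `0`. -/
lemma RunAssumptions.one_le (hr : RunAssumptions A f ν μ ξ L R β ρ l T δhat) : 1 ≤ m := by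
  by_contra h
  have hm : m = 0 := by omega
  subst hm
  have := hr.δ_le
  simp only [Nat.cast_zero, zero_mul, div_zero] at this
  exact absurd hr.δ_pos (not_lt.2 this)

lemma RunAssumptions.mul_δ_le (hr : RunAssumptions A f ν μ ξ L R β ρ l T δhat) :
    m * T * A.δ ≤ δhat := by
  have hm : (0 : ℝ) < m := by exact_mod_cast hr.one_le
  have hT : (0 : ℝ) < T := by exact_mod_cast hr.T_pos
  have := hr.δ_le
  rw [le_div_iff₀ (by positivity)] at this
  linarith

lemma RunAssumptions.δ_le_one (hr : RunAssumptions A f ν μ ξ L R β ρ l T δhat) : A.δ ≤ 1 := by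
  have hm : (1 : ℝ) ≤ m := by exact_mod_cast hr.one_le
  have hT : (1 : ℝ) ≤ T := by exact_mod_cast hr.T_pos
  have h1 := hr.mul_δ_le
  have h2 := hr.δhat_mem.2
  have h3 : A.δ ≤ m * T * A.δ :=
    le_mul_of_one_le_left hr.δ_pos.le (one_le_mul_of_one_le_of_one_le hm hT)
  linarith

lemma RunAssumptions.log_nonneg (hr : RunAssumptions A f ν μ ξ L R β ρ l T δhat) :
    0 ≤ Real.log (1 / A.δ) :=
  Real.log_nonneg ((one_le_div hr.δ_pos).2 hr.δ_le_one)

lemma RunAssumptions.runConclusion [IsProbabilityMeasure ν] [IsProbabilityMeasure μ] {κ : ℝ}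
    (hr : RunAssumptions A f ν μ ξ L R β ρ l T δhat) (hL : ∀ i, 0 < L i) (hM : ∀ i, 0 < A.M i)
    (hl : 0 < l) (hρ : 0 < ρ) (hκ : IsNoiseConst m A.M (⨆ i, L i) (distConst L l) ρ κ)
    (hσ : ∀ i, A.σn i * √(1 + Real.log (1 / A.δ)) ≤ κ * A.η ^ 2)
    (hσh : ∀ i, A.σhatn i * √(1 + Real.log (1 / A.δ)) ≤ κ * A.η)
    (hb : ∀ i, A.bhat i ≤ κ * A.η) : RunConclusion A f μ ξ L l T δhat := by
  have hη := hr.η_pos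
  have hκ0 := hκ.pos
  have hsqrt : √(Real.log (1 / A.δ)) ≤ √(1 + Real.log (1 / A.δ)) :=
    Real.sqrt_le_sqrt (by linarith)
  have hσ0 : ∀ i, 0 ≤ A.σn i := fun i => div_nonneg (hr.noise_nonneg i).1 (Real.sqrt_nonneg _)
  have hσh0 : ∀ i, 0 ≤ A.σhatn i := fun i =>
    div_nonneg (hr.noise_nonneg i).2.1 (Real.sqrt_nonneg _)
  have hn : A.SmallNoise κ :=
    ⟨fun i => mul_nonneg (hσ0 i) (Real.sqrt_nonneg _),
      fun i => (mul_le_mul_of_nonneg_left hsqrt (hσ0 i)).trans (hσ i),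
      fun i => mul_nonneg (hσh0 i) (Real.sqrt_nonneg _),
      fun i => (mul_le_mul_of_nonneg_left hsqrt (hσh0 i)).trans (hσh i),
      fun i => (hr.noise_nonneg i).2.2, hb⟩
  refine ⟨hr.problem.exists_isMinOn hρ hη, ?_⟩
  obtain ⟨S, hSm, hSp, hS⟩ := LBSGD.exists_accurate_event hr.one_le hr.problem.continuous hr.oracle
    hr.samples hr.n_pos hr.δ_pos hr.δ_le_one (a := κ * A.η ^ 2) (b := κ * A.η) (by positivity)
    (by positivity) hσ hσh T
  refine ⟨S, hSm, by linarith [hr.mul_δ_le], fun ω hω => ?_⟩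
  refine LBSGD.run_of_isAccurate hn hr.problem hr.one_le hL hl hρ hη hr.η_le hκ hM
    (fun t ht hx => ?_) hr.T_pos hr.T_ge
  obtain ⟨h1, h2⟩ := hS ω hω t ht hx
  exact ⟨h1, fun i => (h2 i).trans (by linarith [hb i])⟩

end Run

/-! ### Batch size and number of oracle calls -/

lemma div_sqrt_mul_sqrt_le {s b n Λ : ℝ} (hn : 0 < n) (hΛ : 0 ≤ Λ) (hb : 0 ≤ b)
    (h : s ^ 2 * Λ ≤ b ^ 2 * n) : s / √n * √Λ ≤ b := by
  refine le_of_sq_le_sq ?_ hb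
  rw [mul_pow, div_pow, Real.sq_sqrt hn.le, Real.sq_sqrt hΛ, div_mul_eq_mul_div, div_le_iff₀ hn]
  exact h

lemma stepConst_anti {m : ℕ} {L M : Fin (m + 1) → ℝ} {l η ρ : ℝ} (hL : 0 < ⨆ i, L i)
    (hM : 0 < ⨆ i, M i) (hl : 0 < l) (h : η ≤ ρ) :
    stepConst L M l ρ ≤ stepConst L M l η := by
  have hc := distConst_pos hL hl
  unfold stepConst
  refine mul_le_mul_of_nonneg_left
    (one_div_le_one_div_of_le (lt_max_of_lt_right (by positivity)) ?_) (by positivity)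
  gcongr

/-- The gap of the barrier is bounded in terms of the diameter, uniformly in `η ≤ ρ`. -/
lemma ProblemAssumptions.logBarrier_sub_barrierMin_le {d m : ℕ} {f : Fin (m + 1) → Euc d → ℝ}
    {x₀ : Euc d} {L M : Fin (m + 1) → ℝ} {R β ρ l η : ℝ}
    (hp : ProblemAssumptions f x₀ L M R β ρ l) (hL : ∀ i, 0 < L i) (hρ : 0 < ρ) (hη : 0 < η)
    (hηρ : η ≤ ρ) :
    logBarrier f η x₀ - barrierMin f η ≤ L 0 * R + ρ * ∑ i : Fin m, L i.succ * R / β := by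
  obtain ⟨y, hy, hmin⟩ := hp.exists_isMinOn hρ hη
  have hx₀ := hp.start_mem hρ
  have hx₀f := strictlyFeasible_subset f hx₀
  have hyf := strictlyFeasible_subset f hy
  have hβ : 0 < β := by have := hp.rho_le; linarith
  have hR : 0 ≤ R := (norm_nonneg _).trans (hp.diameter x₀ hx₀f y hyf)
  have hlip : ∀ i, f i x₀ - f i y ≤ L i * R := fun i =>
    (le_abs_self _).trans ((hp.lipschitz i x₀ hx₀f y hyf).trans
      (mul_le_mul_of_nonneg_left (hp.diameter x₀ hx₀f y hyf) (hL i).le))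
  have hterm : ∀ i : Fin m,
      -Real.log (-f i.succ x₀) - -Real.log (-f i.succ y) ≤ L i.succ * R / β := by
    intro i
    have h0 : 0 < -f i.succ x₀ := neg_pos.2 (hx₀ i)
    have h1 : 0 < -f i.succ y := neg_pos.2 (hy i)
    have h2 := Real.log_le_sub_one_of_pos (div_pos h1 h0)
    rw [Real.log_div h1.ne' h0.ne'] at h2
    have h3 : -f i.succ y / -f i.succ x₀ - 1 = (f i.succ x₀ - f i.succ y) / -f i.succ x₀ := by
      rw [div_sub_one h0.ne']; ring
    have h4 : (f i.succ x₀ - f i.succ y) / -f i.succ x₀ ≤ L i.succ * R / β := by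
      have := (hL i.succ).le
      exact div_le_div₀ (by positivity) (hlip _) hβ (by linarith [hp.start i])
    linarith
  have hsum := Finset.sum_le_sum fun i (_ : i ∈ Finset.univ) => hterm i
  rw [Finset.sum_sub_distrib] at hsum
  have hS0 : 0 ≤ ∑ i : Fin m, L i.succ * R / β := Finset.sum_nonneg fun i _ => by
    have := (hL i.succ).le
    positivity
  rw [barrierMin_eq hy hmin, logBarrier, logBarrier]
  have h1 := mul_le_mul_of_nonneg_left hsum hη.le
  have h2 := mul_le_mul_of_nonneg_right hηρ hS0
  have h3 := hlip 0
  linarith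

theorem theorem2 (m : ℕ) (L M : Fin (m + 1) → ℝ) (l ρ : ℝ)
    (hL : ∀ i, 0 < L i) (hM : ∀ i, 0 < M i) (hl : 0 < l) (hρ : 0 < ρ) :
    ∃ κ : ℝ, 0 < κ ∧
      -- the noise levels that suffice: `O(η²)` for values, `O(η)` for gradients and their bias
      (∀ (d : ℕ) (Ξ : Type u) (Ω : Type v) [MeasurableSpace Ξ] [MeasurableSpace Ω]
          (ν : MeasureTheory.Measure Ξ) [MeasureTheory.IsProbabilityMeasure ν]
          (μ : MeasureTheory.Measure Ω) [MeasureTheory.IsProbabilityMeasure μ]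
          (f : Fin (m + 1) → Euc d → ℝ) (A : LBSGD d m Ξ) (ξ : ℕ → Fin A.n → Ω → Ξ)
          (R β : ℝ) (T : ℕ) (δhat : ℝ),
        A.M = M →
        RunAssumptions A f ν μ ξ L R β ρ l T δhat →
        (∀ i, A.σn i * √(1 + Real.log (1 / A.δ)) ≤ κ * A.η ^ 2) →
        (∀ i, A.σhatn i * √(1 + Real.log (1 / A.δ)) ≤ κ * A.η) →
        (∀ i, A.bhat i ≤ κ * A.η) →
        RunConclusion A f μ ξ L l T δhat) ∧
      -- for constant `σ_i`, `σhat_i`: batches of size `O(η⁻⁴)`, `O(η⁻⁷)` oracle calls in total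
      (∀ (σ σhat : Fin (m + 1) → ℝ) (R β : ℝ), ∃ K₁ K₂ : ℝ, 0 < K₁ ∧ 0 < K₂ ∧
        ∀ (d : ℕ) (Ξ : Type u) (Ω : Type v) [MeasurableSpace Ξ] [MeasurableSpace Ω]
          (ν : MeasureTheory.Measure Ξ) [MeasureTheory.IsProbabilityMeasure ν]
          (μ : MeasureTheory.Measure Ω) [MeasureTheory.IsProbabilityMeasure μ]
          (f : Fin (m + 1) → Euc d → ℝ) (A : LBSGD d m Ξ) (ξ : ℕ → Fin A.n → Ω → Ξ)
          (T : ℕ) (δhat : ℝ),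
        A.M = M → A.σ = σ → A.σhat = σhat →
        RunAssumptions A f ν μ ξ L R β ρ l T δhat →
        (∀ i, A.bhat i ≤ κ * A.η) →
        A.n = ⌈K₁ * (1 + Real.log (1 / A.δ)) / A.η ^ 4⌉₊ →
        (T : ℝ) ≤ iterBound f A.x₀ L M l A.η + 1 →
        RunConclusion A f μ ξ L l T δhat ∧
        (oracleCalls m A.n T : ℝ) ≤ K₂ * (1 + Real.log (1 / A.δ)) / A.η ^ 7) := by
  have hLm : 0 < ⨆ i, L i := (hL 0).trans_le (le_ciSup (Finite.bddAbove_range L) 0)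
  have hMm : 0 < ⨆ i, M i := (hM 0).trans_le (le_ciSup (Finite.bddAbove_range M) 0)
  obtain ⟨κ, hκ⟩ := exists_isNoiseConst m hM hLm (distConst_pos hLm hl) hρ
  have hκ0 := hκ.pos
  have partA : ∀ (d : ℕ) (Ξ : Type u) (Ω : Type v) [MeasurableSpace Ξ] [MeasurableSpace Ω]
      (ν : Measure Ξ) [IsProbabilityMeasure ν] (μ : Measure Ω) [IsProbabilityMeasure μ]
      (f : Fin (m + 1) → Euc d → ℝ) (A : LBSGD d m Ξ) (ξ : ℕ → Fin A.n → Ω → Ξ)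
      (R β : ℝ) (T : ℕ) (δhat : ℝ), A.M = M →
      RunAssumptions A f ν μ ξ L R β ρ l T δhat →
      (∀ i, A.σn i * √(1 + Real.log (1 / A.δ)) ≤ κ * A.η ^ 2) →
      (∀ i, A.σhatn i * √(1 + Real.log (1 / A.δ)) ≤ κ * A.η) →
      (∀ i, A.bhat i ≤ κ * A.η) → RunConclusion A f μ ξ L l T δhat := by
    intro d Ξ Ω _ _ ν _ μ _ f A ξ R β T δhat hAM hr
    subst hAM
    exact hr.runConclusion hL hM hl hρ hκ
  refine ⟨κ, hκ0, partA, fun σ σhat R β => ?_⟩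
  set V := |L 0 * R + ρ * ∑ i : Fin m, L i.succ * R / β| with hV
  have hV0 : 0 ≤ V := abs_nonneg _
  set K₁ := 1 + ∑ i, (σ i ^ 2 + σhat i ^ 2 * ρ ^ 2) / κ ^ 2 with hK₁
  have hsum0 : ∀ i, 0 ≤ (σ i ^ 2 + σhat i ^ 2 * ρ ^ 2) / κ ^ 2 := fun i => by positivity
  have hK₁0 : 0 < K₁ := add_pos_of_pos_of_nonneg one_pos (Finset.sum_nonneg fun i _ => hsum0 i)
  have hC₀ : 0 < stepConst L M l ρ := stepConst_pos hLm hl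
  refine ⟨K₁, (m + 1) * (K₁ + ρ ^ 4) * (11 * V / stepConst L M l ρ + ρ ^ 3), hK₁0,
    by positivity, ?_⟩
  intro d Ξ Ω _ _ ν _ μ _ f A ξ T δhat hAM hAσ hAσh hr hb hn hT
  have hη := hr.η_pos
  have hηρ := hr.η_le
  have hlog := hr.log_nonneg
  set Λ := 1 + Real.log (1 / A.δ) with hΛ
  have hΛ1 : 1 ≤ Λ := by linarith
  have hn0 : (0 : ℝ) < A.n := by exact_mod_cast hr.n_pos
  have hnle : K₁ * Λ ≤ A.n * A.η ^ 4 := by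
    rw [← div_le_iff₀ (by positivity), hn]
    exact Nat.le_ceil _
  have hκK : ∀ i, σ i ^ 2 + σhat i ^ 2 * ρ ^ 2 ≤ κ ^ 2 * K₁ := fun i => by
    have h1 := Finset.single_le_sum (f := fun i => (σ i ^ 2 + σhat i ^ 2 * ρ ^ 2) / κ ^ 2)
      (fun i _ => hsum0 i) (Finset.mem_univ i)
    have h2 : (σ i ^ 2 + σhat i ^ 2 * ρ ^ 2) / κ ^ 2 ≤ K₁ := by rw [hK₁]; linarith
    rw [div_le_iff₀ (by positivity)] at h2
    linarith
  have hκn : κ ^ 2 * K₁ * Λ ≤ κ ^ 2 * (A.n * A.η ^ 4) := by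
    rw [mul_assoc]; gcongr
  have hbase : ∀ i, (σ i ^ 2 + σhat i ^ 2 * ρ ^ 2) * Λ ≤ κ ^ 2 * (A.n * A.η ^ 4) := fun i =>
    (mul_le_mul_of_nonneg_right (hκK i) (by linarith)).trans hκn
  constructor
  · refine partA d Ξ Ω ν μ f A ξ R β T δhat hAM hr (fun i => ?_) (fun i => ?_) hb
    · rw [LBSGD.σn, hAσ]
      refine div_sqrt_mul_sqrt_le hn0 (by linarith) (by positivity) ?_
      have h1 : 0 ≤ σhat i ^ 2 * ρ ^ 2 * Λ := by positivity
      linarith [hbase i]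
    · rw [LBSGD.σhatn, hAσh]
      refine div_sqrt_mul_sqrt_le hn0 (by linarith) (by positivity) ?_
      have h1 : 0 ≤ σ i ^ 2 * Λ := by positivity
      have h2 : A.η ^ 2 ≤ ρ ^ 2 := by gcongr
      have h3 : κ ^ 2 * A.n * A.η ^ 2 * A.η ^ 2 ≤ κ ^ 2 * A.n * A.η ^ 2 * ρ ^ 2 := by gcongr
      refine le_of_mul_le_mul_right ?_ (by positivity : 0 < ρ ^ 2)
      linarith [hbase i]
  · have hnup : (A.n : ℝ) ≤ (K₁ + ρ ^ 4) * Λ / A.η ^ 4 := by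
      have h1 : (A.n : ℝ) ≤ K₁ * Λ / A.η ^ 4 + 1 := by
        rw [hn]; exact (Nat.ceil_lt_add_one (by positivity)).le
      have h2 : 1 ≤ ρ ^ 4 * Λ / A.η ^ 4 := by
        rw [one_le_div (by positivity)]
        have : A.η ^ 4 ≤ ρ ^ 4 := by gcongr
        nlinarith [pow_pos hρ 4]
      rw [add_mul, add_div]
      linarith
    have hTup : (T : ℝ) ≤ (11 * V / stepConst L M l ρ + ρ ^ 3) / A.η ^ 3 := by
      have h1 : 1 ≤ ρ ^ 3 / A.η ^ 3 := by
        rw [one_le_div (by positivity)]; gcongr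
      have h2 : iterBound f A.x₀ L M l A.η ≤ 11 * V / stepConst L M l ρ / A.η ^ 3 := by
        rw [iterBound, div_div]
        have h3 := (hr.problem.logBarrier_sub_barrierMin_le hL hρ hη hηρ).trans (le_abs_self _)
        have h4 := stepConst_anti hLm hMm hl hηρ
        exact div_le_div₀ (by positivity) (by linarith) (by positivity) (by gcongr)
      rw [add_div]
      linarith
    rw [oracleCalls]
    push_cast
    calc ((m : ℝ) + 1) * A.n * T ≤ (m + 1) * ((K₁ + ρ ^ 4) * Λ / A.η ^ 4) *
          ((11 * V / stepConst L M l ρ + ρ ^ 3) / A.η ^ 3) := by gcongr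
      _ = _ := by field_simp
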